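/- Let $s>1$. There is a constant $C>0$ depending only on $s$ such that the following holds. **Setting.** Let $p\in(1,2]$, $v>0$, $\delta\in(0,1)$. Let $(\mathbb B,\|\cdot\|)$ be a separable real Banach space that is $\beta$-smooth for some $\beta>0$, i.e. $\|x+y\|^2+\|x-y\|^2\le 2\|x\|^2+2\beta^2\|y\|^2$ for all $x,y\in\mathbb B$. Let $(X_n)_{n\ge1}$ be $\mathbb B$-valued random variables adapted to a filtration $(\mathcal F_n)_{n\ge0}$ with, for all $n\ge1$, $\mathbb E(X_n\mid\mathcal F_{n-1})=\mu$ and $\mathbb E(\|X_n-\mu\|^p\mid\mathcal F_{n-1})\le v$ almost surely. Put $h(x):=(x+1)^s\zeta(s)$. Let $k:\mathbb N_0\to\mathbb N_0$ be nondecreasing with $k(\lfloor\log_2 n\rfloor)=o(n)$, and let $n_0$ be such that $k(\lfloor\log_2 n\rfloor)\le n/2$ for all $n\ge n_0$. For $j\ge1$ let $\widehat Z_j=\widehat Z_j(X_1,\dots,X_{k(j)})$ be a measurable function of the first $k(j)$ observations, and let $r:(0,1)\times\mathbb N_0\to\mathbb R$ satisfy $$\mathbb P\big(\|\widehat Z_j-\mu\|\ge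 r(\varepsilon,k(j))\big)\le\varepsilon\qquad\text{for all }\varepsilon\in(0,1),\ j\ge1.$$ Suppose that $$r_n:=r\!\left(\frac{\delta}{2h(\lfloor\log_2 n\rfloor)},\,k(\lfloor\log_2 n\rfloor)\right)\to0\qquad(n\to\infty).$$ **Estimator.** Let $\mathtt{Trunc}(x):=(1\wedge\|x\|)/\|x\|$ for $x\ne0$, $\mathtt{Trunc}(0):=1$, $K_p:=\frac1p\big(\frac{p-1}{p}\big)^{p-1}$, and $\mathfrak C_p(\mathbb B):=c_p\,\frac{e^{2/\beta}-2/\beta-1}{(2/\beta)^2}$, where $c_p=2^{p-1}$ if $\mathbb B$ is a Hilbert space and $c_p=2^{p+1}$ otherwise. For $j\ge1$ set $$\lambda_j:=\left(\frac{\beta\log(4h(j)/\delta)}{2^j\,(\beta\mathfrak C_p(\mathbb B)+2^{p-1}K_p)\,\big(v+r(\tfrac{\delta}{2h(j)},k(j))^p\big)}\right)^{1/p},$$ and for $n\ge2$, with $j=\lfloor\log_2 n\rfloor$ (so $n\in[2^j,2^{j+1})$), $$\widehat\mu_n:=\frac1{n-k(j)}\sum_{m=k(j)+1}^{n}\Big\{\mathtt{Trunc}\big(\lambda_j(X_m-\widehat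 Z_j)\big)(X_m-\widehat Z_j)+\widehat Z_j\Big\}.$$ **Conclusion.** There are $A>0$ and $N\in\mathbb N$, depending only on $(s,p,v,\delta,k,n_0,r)$ (not on $\mathbb B$, $\beta$, $\mu$, the law of $(X_n)$ or the estimators $\widehat Z_j$), such that with probability at least $1-\delta$ the following bounds hold simultaneously: $$\|\widehat\mu_n-\mu\|\le A\,\beta v^{1/p}\left(\frac{\log(\log(n)/\delta)}{n}\right)^{(p-1)/p}\quad\text{for all } n\ge\max(n_0,3),$$ $$\|\widehat\mu_n-\mu\|\le C\,\beta v^{1/p}\left(\frac{\log(\log(n)/\delta)}{n}\right)^{(p-1)/p}\quad\text{for all } n\ge N.$$ -/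

import Mathlib

open MeasureTheory ProbabilityTheory Filter Topology Asymptotics

noncomputable section

namespace BanachMean

/-- A function `f` on a normed space is `(2, β)`-smooth. -/
def IsTwoSmooth {B : Type*} [NormedAddCommGroup B] (β : ℝ) (f : B → ℝ) : Prop :=
  f 0 = 0 ∧ (∀ x y : B, |f (x + y) - f x| ≤ ‖y‖) ∧
    ∀ x y : B, f (x + y) ^ 2 + f (x - y) ^ 2 ≤ 2 * f x ^ 2 + 2 * β ^ 2 * ‖y‖ ^ 2

/-- A normed space is `β`-smooth if its norm is `(2, β)`-smooth. -/
def IsSmoothSpace (B : Type*) [NormedAddCommGroup B] (β : ℝ) : Prop :=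
  IsTwoSmooth β (fun x : B => ‖x‖)

/-- `X 1, X 2, …` is adapted to `(ℱ n)_{n ≥ 0}`, with constant conditional mean `m` and with
conditional central `p`-th moments at most `v`. The value `X 0` plays no role. The integrability
fields only say that the two conditional expectations are genuine ones. -/
structure MeanAssumption {Ω B : Type*} {mΩ : MeasurableSpace Ω} [NormedAddCommGroup B]
    [NormedSpace ℝ B] [CompleteSpace B] (P : Measure Ω) (ℱ : Filtration ℕ mΩ) (X : ℕ → Ω → B)
    (m : B) (p v : ℝ) : Prop where
  adapted : ∀ n : ℕ, 1 ≤ n → StronglyMeasurable[ℱ n] (X n)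
  integrable : ∀ n : ℕ, 1 ≤ n → Integrable (X n) P
  cond_mean : ∀ n : ℕ, 1 ≤ n → P[X n | ℱ (n - 1)] =ᵐ[P] fun _ => m
  integrable_moment : ∀ n : ℕ, 1 ≤ n → Integrable (fun ω => ‖X n ω - m‖ ^ p) P
  cond_moment : ∀ n : ℕ, 1 ≤ n →
    P[fun ω => ‖X n ω - m‖ ^ p | ℱ (n - 1)] ≤ᵐ[P] fun _ => v

open Classical in
/-- The truncation factor `(1 ∧ ‖x‖) / ‖x‖`, equal to `1` at `x = 0`. -/
def trunc {B : Type*} [NormedAddCommGroup B] (x : B) : ℝ :=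
  if x = 0 then 1 else min 1 ‖x‖ / ‖x‖

/-- The constant `K_p`. -/
def Kconst (p : ℝ) : ℝ := 1 / p * ((p - 1) / p) ^ (p - 1)

open Classical in
/-- The constant `ℭ_p(B)`; the smaller value is for norms induced by an inner product. -/
def Cconst (B : Type*) [NormedAddCommGroup B] (p β : ℝ) : ℝ :=
  (if Nonempty (InnerProductSpace ℝ B) then (2 : ℝ) ^ (p - 1) else (2 : ℝ) ^ (p + 1)) *
    ((Real.exp (2 * β⁻¹) - 2 * β⁻¹ - 1) / (2 * β⁻¹) ^ 2)

/-- The stitching function `h(x) = (x + 1)^s ζ(s)`. -/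
def stitch (s x : ℝ) : ℝ := (x + 1) ^ s * (riemannZeta (s : ℂ)).re

/-- The initial-estimate rate `r(δ / (2 h(j)), k(j))` of epoch `j`. -/
def epochRate (s δ : ℝ) (k : ℕ → ℕ) (r : ℝ → ℕ → ℝ) (j : ℕ) : ℝ :=
  r ((stitch s (j : ℝ))⁻¹ * δ / 2) (k j)

/-- The truncation level `λ_j` of epoch `j`:
`(β log(4 h(j) / δ) / (2^j (β ℭ_p(B) + 2^(p-1) K_p) (v + r(δ / (2 h(j)), k(j))^p)))^(1/p)`. -/
def truncLevel (B : Type*) [NormedAddCommGroup B] (s p β v δ : ℝ) (k : ℕ → ℕ)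
    (r : ℝ → ℕ → ℝ) (j : ℕ) : ℝ :=
  (β * Real.log (4 * stitch s (j : ℝ) / δ) /
    (2 ^ j * ((β * Cconst B p β + 2 ^ (p - 1) * Kconst p) *
      (v + epochRate s δ k r j ^ p)))) ^ (1 / p)

/-- The initial estimate `Ẑ_j = Ẑ_j(X_1, …, X_{k(j)})`. -/
def initEst {Ω B : Type*} (k : ℕ → ℕ) (Zhat : (j : ℕ) → (Fin (k j) → B) → B)
    (X : ℕ → Ω → B) (j : ℕ) (ω : Ω) : B :=
  Zhat j (fun i => X (i + 1) ω)

/-- Truncated mean of `X_{k+1}, …, X_n`, centered at `z`, at truncation level `lam`. -/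
def truncMean {B : Type*} [NormedAddCommGroup B] [NormedSpace ℝ B] (x : ℕ → B) (k n : ℕ)
    (lam : ℝ) (z : B) : B :=
  ((n : ℝ) - (k : ℝ))⁻¹ •
    ∑ i ∈ Finset.Ioc k n, (trunc (lam • (x i - z)) • (x i - z) + z)

/-- The stitched estimator: for `n` in the epoch `[2^j, 2^(j+1))`, `j ≥ 1`, that is, for `n ≥ 2`
and `j = ⌊log₂ n⌋`, it is the truncated mean with `k(j)`, `λ_j`, `Ẑ_j`. It is `0` for `n < 2`. -/
def stitchedEst {Ω B : Type*} [NormedAddCommGroup B] [NormedSpace ℝ B]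
    (s p β v δ : ℝ) (k : ℕ → ℕ) (r : ℝ → ℕ → ℝ) (Zhat : (j : ℕ) → (Fin (k j) → B) → B)
    (X : ℕ → Ω → B) (n : ℕ) (ω : Ω) : B :=
  if 2 ≤ n then
    truncMean (fun i => X i ω) (k (Nat.log 2 n)) n (truncLevel B s p β v δ k r (Nat.log 2 n))
      (initEst k Zhat X (Nat.log 2 n) ω)
  else 0

/-- The iterated-logarithm rate `β v^(1/p) (log(log n / δ) / n)^((p-1)/p)`. -/
def lilRate (p β v δ : ℝ) (n : ℕ) : ℝ :=
  β * v ^ (1 / p) * (Real.log (Real.log n / δ) / n) ^ ((p - 1) / p)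

end BanachMean

end

/-! In a β-smooth space `‖x‖²` has a Lipschitz gradient, so `exp √(1 + ‖x‖²)`, a smooth proxy for
`exp ‖x‖`, changes under a small increment `y` by a factor of at most `1 + ℓ y + 4β²‖y‖²` with `ℓ`
linear (`IsSmoothSpace.exists_potential_le`). Along a martingale `S` with small increments and
conditional second moments at most `σ`, the linear term averages to zero, so the potential of `S n`
discounted by `exp (4β²σ)` per step is a supermartingale. Ville's inequality then controls `‖S n‖`
uniformly over an epoch (`IsSmoothSpace.measure_norm_sum_gt_le`).

Truncation at level `λ` produces such a martingale from heavy tails. If the initial estimate has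
error at most `ρ`, a truncated observation is bounded by `1/λ`, its conditional variance is of order
`λ^(p-2) (v + ρ^p)` and its bias of order `λ^(p-1) (v + ρ^p)`. The level `λ_j` balances deviation
against bias (`balanced_bound_le`), giving `β (v + ρ^p)^(1/p) (L / 2^j)^((p-1)/p)` with `L = log (4
h(j) / δ)`, up to a numerical factor.

Epoch `j` fails with probability at most `δ / h(j)`, and these sum to `δ`. On an epoch `L` is at
most a multiple, depending on `s`, of `log (log n / δ)`. Once `r_n^p < v`, the factor `v + r_n^p` is
at most `2v`, whence `C`; before that, boundedness of `r_n` gives `A`. -/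

namespace BanachMean

/-! ### Geometry of smooth spaces and the exponential potential. -/

/-- A nontrivial `β`-smooth space with `β > 0` has `β ≥ 1`. -/
theorem IsSmoothSpace.one_le {B : Type*} [NormedAddCommGroup B] [Nontrivial B] {β : ℝ}
    (h : IsSmoothSpace B β) (hβ : 0 < β) : 1 ≤ β := by
  obtain ⟨y, hy⟩ := exists_ne (0 : B)
  have h1 := h.2.2 0 y
  simp only [zero_add, zero_sub, norm_neg, norm_zero] at h1
  have h2 : 0 < ‖y‖ ^ 2 := by positivity
  by_contra! h3
  nlinarith [mul_lt_mul_of_pos_right (show β ^ 2 < 1 by nlinarith) h2]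

/-- In a `β`-smooth space the squared norm has a continuous gradient, and its first-order expansion
has a quadratic remainder. -/
theorem IsSmoothSpace.exists_gradient {B : Type*} [NormedAddCommGroup B] [NormedSpace ℝ B] {β : ℝ}
    (h : IsSmoothSpace B β) :
    ∃ G : B → (B →L[ℝ] ℝ), Continuous G ∧ (∀ x, ‖G x‖ ≤ 2 * ‖x‖) ∧
      ∀ x y, ‖x + y‖ ^ 2 ≤ ‖x‖ ^ 2 + G x y + 2 * β ^ 2 * ‖y‖ ^ 2 := by
  -- Hahn–Banach norming functionals; `2‖x‖ f x` is a subgradient of the squared norm. This gives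
  -- the lower bound `hlow`, and inserting `hlow` at `-y` into the smoothness inequality gives the
  -- upper bound `hup`.
  choose f hf1 hf2 using fun x : B => exists_dual_vector'' ℝ x
  have hfle : ∀ x y, f x y ≤ ‖y‖ ∧ -‖y‖ ≤ f x y := fun x y => by
    have h1 : ‖f x y‖ ≤ ‖y‖ := by
      simpa using (f x).le_of_opNorm_le (hf1 x) y
    rw [Real.norm_eq_abs, abs_le] at h1
    exact ⟨h1.2, h1.1⟩
  let G : B → (B →L[ℝ] ℝ) := fun x => (2 * ‖x‖) • f x
  have hG : ∀ x y, G x y = 2 * ‖x‖ * f x y := fun x y => by simp [G]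
  have hlow : ∀ x y, ‖x‖ ^ 2 + G x y ≤ ‖x + y‖ ^ 2 := fun x y => by
    have h1 := hfle x (x + y)
    have h2 : f x (x + y) = ‖x‖ + f x y := by
      rw [map_add, hf2]; simp
    have h3 : (f x (x + y)) ^ 2 ≤ ‖x + y‖ ^ 2 := sq_le_sq' h1.2 h1.1
    rw [hG]
    nlinarith [sq_nonneg (f x y)]
  have hup : ∀ x y, ‖x + y‖ ^ 2 ≤ ‖x‖ ^ 2 + G x y + 2 * β ^ 2 * ‖y‖ ^ 2 := fun x y => by
    have h1 := h.2.2 x y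
    have h2 := hlow x (-y)
    rw [map_neg, ← sub_eq_add_neg x y] at h2
    simp only at h1
    linarith
  refine ⟨G, ?_, fun x => ?_, hup⟩
  -- Continuity of `G` comes from a Lipschitz bound: compare the lower expansion of `‖z + y‖²` at
  -- `z` with its upper expansion at `x`. The error is `2β²‖z - x + y‖²`, hence the choice of `y` as
  -- long as `z - x`; general `y` follows by rescaling.
  · have key : ∀ x z y : B, ‖y‖ = ‖z - x‖ → G z y - G x y ≤ 8 * β ^ 2 * ‖z - x‖ ^ 2 := by
      intro x z y hy
      have h1 := hlow z y
      have h2 := hup x (z - x + y)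
      have h3 := hlow x (z - x)
      have e1 : x + (z - x + y) = z + y := by abel
      have e2 : x + (z - x) = z := by abel
      rw [e1, map_add] at h2
      rw [e2] at h3
      have h4 : ‖z - x + y‖ ≤ 2 * ‖z - x‖ := (norm_add_le _ _).trans (by rw [hy]; linarith)
      have h5 : ‖z - x + y‖ ^ 2 ≤ (2 * ‖z - x‖) ^ 2 := by gcongr
      nlinarith [mul_le_mul_of_nonneg_left h5 (by positivity : 0 ≤ 2 * β ^ 2)]
    have hlip : LipschitzWith (Real.toNNReal (8 * β ^ 2)) G := by
      refine LipschitzWith.of_dist_le_mul fun z x => ?_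
      rw [dist_eq_norm, dist_eq_norm, Real.coe_toNNReal _ (by positivity)]
      rcases eq_or_ne z x with rfl | hzx
      · simp
      have ht : 0 < ‖z - x‖ := norm_pos_iff.2 (sub_ne_zero.2 hzx)
      have half : ∀ y : B, G z y - G x y ≤ 8 * β ^ 2 * ‖z - x‖ * ‖y‖ := by
        intro y
        rcases eq_or_ne y 0 with rfl | hy
        · simp
        have hy' : 0 < ‖y‖ := norm_pos_iff.2 hy
        have h1 := key x z ((‖z - x‖ / ‖y‖) • y) (by
          rw [norm_smul, Real.norm_of_nonneg (by positivity)]; field_simp)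
        simp only [map_smul, smul_eq_mul] at h1
        have h2 : ‖z - x‖ / ‖y‖ * (G z y - G x y)
            ≤ ‖z - x‖ / ‖y‖ * (8 * β ^ 2 * ‖z - x‖ * ‖y‖) := by
          calc _ ≤ 8 * β ^ 2 * ‖z - x‖ ^ 2 := by linarith
            _ = _ := by field_simp
        exact le_of_mul_le_mul_left h2 (by positivity)
      refine ContinuousLinearMap.opNorm_le_bound _ (by positivity) fun y => ?_
      rw [Real.norm_eq_abs, abs_le, sub_apply]
      have h1 := half y
      have h2 := half (-y)
      simp only [map_neg, norm_neg] at h2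
      constructor <;> linarith
    exact hlip.continuous
  · rw [norm_smul, Real.norm_of_nonneg (by positivity)]
    exact mul_le_of_le_one_right (by positivity) (hf1 x)

/-- An exponential potential comparable to `exp ‖x‖`. -/
noncomputable def potential {B : Type*} [NormedAddCommGroup B] (x : B) : ℝ :=
  Real.exp (√(1 + ‖x‖ ^ 2))

theorem potential_pos {B : Type*} [NormedAddCommGroup B] (x : B) : 0 < potential x :=
  Real.exp_pos _

theorem potential_zero {B : Type*} [NormedAddCommGroup B] :
    potential (0 : B) = Real.exp 1 := by
  simp [potential]

theorem continuous_potential {B : Type*} [NormedAddCommGroup B] :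
    Continuous (potential : B → ℝ) := by
  unfold potential; fun_prop

theorem exp_norm_le_potential {B : Type*} [NormedAddCommGroup B] (x : B) :
    Real.exp ‖x‖ ≤ potential x :=
  Real.exp_le_exp.2 (Real.le_sqrt_of_sq_le (by linarith))

theorem potential_le {B : Type*} [NormedAddCommGroup B] {x : B} {R : ℝ} (hx : ‖x‖ ≤ R) :
    potential x ≤ Real.exp (√(1 + R ^ 2)) := by
  unfold potential; gcongr

/-- One-step expansion of the exponential potential in a `β`-smooth space. -/
theorem IsSmoothSpace.exists_potential_le {B : Type*} [NormedAddCommGroup B] [NormedSpace ℝ B]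
    {β : ℝ} (h : IsSmoothSpace B β) (hβ : 1 ≤ β) :
    ∃ ℓ : B → (B →L[ℝ] ℝ), Continuous ℓ ∧ (∀ x, ‖ℓ x‖ ≤ 1) ∧
      ∀ x y, ‖y‖ ≤ 1 / (2 * β) →
        potential (x + y) ≤ potential x * (1 + ℓ x y + 4 * β ^ 2 * ‖y‖ ^ 2) := by
  obtain ⟨G, hGc, hGn, hG⟩ := h.exists_gradient
  have hs : ∀ x : B, 0 < √(1 + ‖x‖ ^ 2) := fun x => by positivity
  have hs2 : ∀ x : B, √(1 + ‖x‖ ^ 2) ^ 2 = 1 + ‖x‖ ^ 2 := fun x => Real.sq_sqrt (by positivity)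
  have hs1 : ∀ x : B, 1 ≤ √(1 + ‖x‖ ^ 2) := fun x => Real.one_le_sqrt.2 (by nlinarith [norm_nonneg x])
  have hsx : ∀ x : B, ‖x‖ ≤ √(1 + ‖x‖ ^ 2) := fun x => Real.le_sqrt_of_sq_le (by linarith)
  have hn : ∀ x, ‖(2 * √(1 + ‖x‖ ^ 2))⁻¹ • G x‖ ≤ 1 := fun x => by
    have := hs x
    rw [norm_smul, Real.norm_of_nonneg (by positivity), inv_mul_le_iff₀ (by positivity)]
    linarith [hGn x, hsx x]
  refine ⟨fun x => (2 * √(1 + ‖x‖ ^ 2))⁻¹ • G x, ?_, hn, fun x y hy => ?_⟩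
  · have hc : Continuous fun x : B => 2 * √(1 + ‖x‖ ^ 2) := by fun_prop
    exact (hc.inv₀ fun x => by have := hs x; positivity).smul hGc
  set t := √(1 + ‖x‖ ^ 2) with ht
  have htp : 0 < t := hs x
  have hl : |((2 * t)⁻¹ • G x) y| ≤ ‖y‖ := by
    simpa using ((2 * t)⁻¹ • G x).le_of_opNorm_le (hn x) y
  have hGy : G x y = 2 * t * ((2 * t)⁻¹ • G x) y := by
    rw [_root_.smul_apply, smul_eq_mul]; field_simp
  set l := ((2 * t)⁻¹ • G x) y with hl_def
  have hby : β * ‖y‖ ≤ 1 / 2 := by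
    rw [le_div_iff₀ (by positivity)] at hy; linarith
  have hb0 : 0 ≤ β * ‖y‖ := by positivity
  have hyy : ‖y‖ ≤ β * ‖y‖ := le_mul_of_one_le_left (norm_nonneg _) hβ
  set b := β * ‖y‖ with hb
  -- Squaring `t + (l + b²/t)` reproduces the expansion of `1 + ‖x + y‖²` plus a square.
  have hroot : √(1 + ‖x + y‖ ^ 2) ≤ t + (l + b ^ 2) := by
    have h1 : √(1 + ‖x + y‖ ^ 2) ≤ t + (l + b ^ 2 / t) := by
      have h0 : 0 ≤ t + (l + b ^ 2 / t) := by
        have : 0 ≤ b ^ 2 / t := by positivity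
        linarith [(abs_le.1 hl).1, hs1 x]
      refine Real.sqrt_le_iff.2 ⟨h0, ?_⟩
      have h2 := hG x y
      rw [hGy] at h2
      have h3 : (t + (l + b ^ 2 / t)) ^ 2 = t ^ 2 + 2 * t * l + 2 * b ^ 2 + (l + b ^ 2 / t) ^ 2 := by
        field_simp
        ring
      rw [h3, hs2]
      have : β ^ 2 * ‖y‖ ^ 2 = b ^ 2 := by rw [hb]; ring
      nlinarith [sq_nonneg (l + b ^ 2 / t)]
    have h2 : b ^ 2 / t ≤ b ^ 2 := div_le_self (by positivity) (hs1 x)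
    linarith
  have hl' := abs_le.1 hl
  have ha : |l + b ^ 2| ≤ 1 := abs_le.2 ⟨by nlinarith, by nlinarith⟩
  -- From `exp a ≤ 1 + a + a²` for `|a| ≤ 1`, with `|l| ≤ b ≤ 1/2`.
  have hexp : Real.exp (l + b ^ 2) ≤ 1 + l + 4 * b ^ 2 := by
    have h1 := (abs_le.1 (Real.abs_exp_sub_one_sub_id_le ha)).2
    have h2 : l ^ 2 ≤ b ^ 2 := sq_le_sq' (by linarith) (by linarith)
    have h3 : b ^ 2 ≤ 1 / 4 := by nlinarith
    nlinarith [mul_le_mul_of_nonneg_left h3 (sq_nonneg b), sq_nonneg (l - b ^ 2)]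
  calc potential (x + y) ≤ Real.exp (t + (l + b ^ 2)) := Real.exp_le_exp.2 hroot
    _ = potential x * Real.exp (l + b ^ 2) := by rw [Real.exp_add, potential]
    _ ≤ potential x * (1 + l + 4 * b ^ 2) := by
        gcongr
        exact (potential_pos x).le
    _ = _ := by rw [hb]; ring

/-! ### Supermartingales and time-uniform concentration. -/

/-- Conditional one-step bound for the exponential potential of a martingale with small
increments. -/
theorem IsSmoothSpace.condExp_potential_le {Ω B : Type*} {m mΩ : MeasurableSpace Ω}
    [NormedAddCommGroup B] [NormedSpace ℝ B] [CompleteSpace B] {P : Measure Ω} [IsFiniteMeasure P]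
    {β : ℝ} (h : IsSmoothSpace B β) (hβ : 1 ≤ β) (hm : m ≤ mΩ) {S ξ : Ω → B} {R σ : ℝ}
    (hS : StronglyMeasurable[m] S) (hSR : ∀ᵐ ω ∂P, ‖S ω‖ ≤ R)
    (hξm : AEStronglyMeasurable ξ P) (hξ : ∀ᵐ ω ∂P, ‖ξ ω‖ ≤ 1 / (2 * β))
    (hξ0 : P[ξ | m] =ᵐ[P] 0) (hξσ : P[fun ω => ‖ξ ω‖ ^ 2 | m] ≤ᵐ[P] fun _ => σ) :
    P[fun ω => potential (S ω + ξ ω) | m] ≤ᵐ[P]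
      fun ω => potential (S ω) * Real.exp (4 * β ^ 2 * σ) := by
  obtain ⟨ℓ, hℓc, hℓn, hℓ⟩ := h.exists_potential_le hβ
  have hSm : AEStronglyMeasurable S P := (hS.mono hm).aestronglyMeasurable
  have hξint : Integrable ξ P := Integrable.of_bound hξm _ hξ
  have hξ2 : Integrable (fun ω => ‖ξ ω‖ ^ 2) P := by
    refine Integrable.of_bound (by fun_prop) ((1 / (2 * β)) ^ 2) ?_
    filter_upwards [hξ] with ω hω
    rw [norm_pow, norm_norm]
    gcongr
  have hpotS : StronglyMeasurable[m] fun ω => potential (S ω) :=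
    continuous_potential.comp_stronglyMeasurable hS
  set M := Real.exp (√(1 + R ^ 2)) with hM
  have hpotb : ∀ᵐ ω ∂P, ‖potential (S ω)‖ ≤ M := by
    filter_upwards [hSR] with ω hω
    rw [Real.norm_of_nonneg (potential_pos _).le]
    exact potential_le hω
  have hpotint : Integrable (fun ω => potential (S ω)) P :=
    Integrable.of_bound (hpotS.mono hm).aestronglyMeasurable M hpotb
  have hsum : Integrable (fun ω => potential (S ω + ξ ω)) P := by
    refine Integrable.of_bound (continuous_potential.comp_aestronglyMeasurable (hSm.add hξm))
      (Real.exp (√(1 + (R + 1 / (2 * β)) ^ 2))) ?_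
    filter_upwards [hSR, hξ] with ω h1 h2
    rw [Real.norm_of_nonneg (potential_pos _).le]
    exact potential_le ((norm_add_le _ _).trans (add_le_add h1 h2))
  -- The linear term is a bounded `m`-measurable functional applied to `ξ`; it pulls out of the
  -- conditional expectation and meets `E[ξ | m] = 0`.
  let D : Ω → (B →L[ℝ] ℝ) := fun ω => potential (S ω) • ℓ (S ω)
  have hD : StronglyMeasurable[m] D := hpotS.smul (hℓc.comp_stronglyMeasurable hS)
  have hDb : ∀ᵐ ω ∂P, ‖D ω‖ ≤ M := by
    filter_upwards [hpotb] with ω h1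
    rw [norm_smul]
    exact (mul_le_of_le_one_right (norm_nonneg _) (hℓn _)).trans h1
  have hDint : Integrable (fun ω => D ω (ξ ω)) P :=
    (ContinuousLinearMap.id ℝ (B →L[ℝ] ℝ)).integrable_of_bilin_of_bdd_left M
      (hD.mono hm).aestronglyMeasurable hDb hξint
  have hD0 : P[fun ω => D ω (ξ ω) | m] =ᵐ[P] 0 := by
    have h1 := condExp_stronglyMeasurable_bilin_of_bound (ContinuousLinearMap.id ℝ (B →L[ℝ] ℝ))
      hm hD hξint M hDb
    filter_upwards [h1, hξ0] with ω h2 h3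
    simpa [h3] using h2
  have hq : Integrable (fun ω => potential (S ω) * ‖ξ ω‖ ^ 2) P :=
    hξ2.bdd_mul (c := M) (hpotS.mono hm).aestronglyMeasurable hpotb
  have hqc : P[fun ω => potential (S ω) * ‖ξ ω‖ ^ 2 | m] =ᵐ[P]
      fun ω => potential (S ω) * P[fun ω => ‖ξ ω‖ ^ 2 | m] ω :=
    condExp_mul_of_stronglyMeasurable_left hpotS hq hξ2
  have hle : (fun ω => potential (S ω + ξ ω)) ≤ᵐ[P]
      (fun ω => potential (S ω)) + ((fun ω => D ω (ξ ω)) +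
        (4 * β ^ 2) • fun ω => potential (S ω) * ‖ξ ω‖ ^ 2) := by
    filter_upwards [hξ] with ω hω
    have := hℓ (S ω) (ξ ω) hω
    simp only [Pi.add_apply, Pi.smul_apply, smul_eq_mul, D, _root_.smul_apply]
    linarith
  have hmono := condExp_mono (m := m) hsum
    (hpotint.add (hDint.add (hq.smul (4 * β ^ 2)))) hle
  have hadd1 := condExp_add hpotint (hDint.add (hq.smul (4 * β ^ 2))) m
  have hadd2 := condExp_add hDint (hq.smul (4 * β ^ 2)) m
  have hsm := condExp_smul (μ := P) (4 * β ^ 2) (fun ω => potential (S ω) * ‖ξ ω‖ ^ 2) m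
  have hself := condExp_of_stronglyMeasurable hm hpotS hpotint
  filter_upwards [hmono, hadd1, hadd2, hsm, hD0, hqc, hξσ] with ω h1 h2 h3 h4 h5 h6 h7
  rw [h2, Pi.add_apply, h3, Pi.add_apply, h4, Pi.smul_apply, h5, h6, hself] at h1
  simp only [Pi.zero_apply, zero_add, smul_eq_mul] at h1
  have hp := potential_pos (S ω)
  have h8 : 1 + 4 * β ^ 2 * σ ≤ Real.exp (4 * β ^ 2 * σ) := by
    linarith [Real.add_one_le_exp (4 * β ^ 2 * σ)]
  calc _ ≤ _ := h1
    _ ≤ potential (S ω) + 4 * β ^ 2 * (potential (S ω) * σ) := by gcongr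
    _ = potential (S ω) * (1 + 4 * β ^ 2 * σ) := by ring
    _ ≤ _ := by gcongr

/-- Ville's maximal inequality over a finite time range, for a nonnegative supermartingale. -/
theorem maximal_ineq_of_condExp_le {Ω : Type*} {mΩ : MeasurableSpace Ω} {P : Measure Ω}
    [IsFiniteMeasure P] {ℱ : Filtration ℕ mΩ} {W : ℕ → Ω → ℝ} {k : ℕ}
    (hW : ∀ n, k ≤ n → StronglyMeasurable[ℱ n] (W n)) (hint : ∀ n, k ≤ n → Integrable (W n) P)
    (hpos : ∀ n ω, 0 ≤ W n ω) (hsup : ∀ n, k ≤ n → P[W (n + 1) | ℱ n] ≤ᵐ[P] W n)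
    (c : ℝ) {T : ℕ} (hT : k ≤ T) :
    c * P.real {ω | ∃ n, k ≤ n ∧ n ≤ T ∧ c ≤ W n ω} ≤ ∫ ω, W k ω ∂P := by
  let A : ℕ → Set Ω := fun T => {ω | ∃ n, k ≤ n ∧ n ≤ T ∧ c ≤ W n ω}
  have hAm : ∀ T, MeasurableSet[ℱ T] (A T) := by
    intro T
    have : A T = ⋃ n, ⋃ (_ : k ≤ n ∧ n ≤ T), {ω | c ≤ W n ω} := by
      ext ω; simp [A, and_assoc]
    rw [this]
    refine MeasurableSet.iUnion fun n => MeasurableSet.iUnion fun hn => ?_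
    exact ℱ.mono hn.2 _ (stronglyMeasurable_const.measurableSet_le (hW n hn.1))
  have hAm' : ∀ T, MeasurableSet (A T) := fun T => ℱ.le T _ (hAm T)
  -- The integrand is `W` stopped on first reaching `c`, with the value there lowered to `c`. Its
  -- mean does not increase: paths newly reaching `c` at `T + 1` are replaced by something no
  -- larger, and on the others the supermartingale property applies, since `(A T)ᶜ` is `ℱ
  -- T`-measurable.
  have key : ∀ T, k ≤ T → ∫ ω, (A T).indicator (fun _ => c) ω + (A T)ᶜ.indicator (W T) ω ∂P
      ≤ ∫ ω, W k ω ∂P := by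
    intro T hT
    induction T, hT using Nat.le_induction with
    | base =>
      refine integral_mono (((integrable_const c).indicator (hAm' k)).add
        ((hint k le_rfl).indicator (hAm' k).compl)) (hint k le_rfl) fun ω => ?_
      by_cases hω : ω ∈ A k
      · obtain ⟨n, h1, h2, h3⟩ := id hω
        obtain rfl : n = k := le_antisymm h2 h1
        simpa [hω] using h3
      · simp [hω]
    | succ T hT ih =>
      refine le_trans ?_ ih
      have hi : ∀ S n, k ≤ n → Integrable (fun ω => (A S).indicator (fun _ => c) ω +
          (A S)ᶜ.indicator (W n) ω) P := fun S n hn =>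
        ((integrable_const c).indicator (hAm' S)).add ((hint n hn).indicator (hAm' S).compl)
      have h1 : ∫ ω, (A (T + 1)).indicator (fun _ => c) ω
            + (A (T + 1))ᶜ.indicator (W (T + 1)) ω ∂P
          ≤ ∫ ω, (A T).indicator (fun _ => c) ω + (A T)ᶜ.indicator (W (T + 1)) ω ∂P := by
        refine integral_mono (hi _ _ (by omega)) (hi _ _ (by omega)) fun ω => ?_
        by_cases h1 : ω ∈ A T
        · have h2 : ω ∈ A (T + 1) := by
            obtain ⟨n, h3, h4, h5⟩ := h1
            exact ⟨n, h3, by omega, h5⟩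
          simp [h1, h2]
        · by_cases h2 : ω ∈ A (T + 1)
          · obtain ⟨n, h3, h4, h5⟩ := id h2
            have : n = T + 1 := by
              by_contra hne
              exact h1 ⟨n, h3, by omega, h5⟩
            subst this
            simpa [h1, h2] using h5
          · simp [h1, h2]
      refine h1.trans ?_
      rw [integral_add ((integrable_const c).indicator (hAm' T))
          ((hint _ (by omega)).indicator (hAm' T).compl),
        integral_add ((integrable_const c).indicator (hAm' T))
          ((hint _ hT).indicator (hAm' T).compl)]
      refine add_le_add le_rfl ?_
      rw [integral_indicator (hAm' T).compl, integral_indicator (hAm' T).compl,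
        ← setIntegral_condExp (ℱ.le T) (hint _ (by omega)) (hAm T).compl]
      exact setIntegral_mono_ae integrable_condExp.integrableOn (hint T hT).integrableOn
        (hsup T hT)
  refine le_trans ?_ (key T hT)
  rw [integral_add ((integrable_const c).indicator (hAm' T))
    ((hint _ hT).indicator (hAm' T).compl), integral_indicator (hAm' T), setIntegral_const,
    smul_eq_mul, mul_comm]
  have : 0 ≤ ∫ ω, (A T)ᶜ.indicator (W T) ω ∂P :=
    integral_nonneg fun ω => Set.indicator_nonneg (fun ω _ => hpos T ω) ω
  exact le_add_of_nonneg_right this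

/-- Time-uniform concentration, over a finite time range, of a martingale with small increments in
a `β`-smooth space. -/
theorem IsSmoothSpace.measure_norm_sum_gt_le {Ω B : Type*} {mΩ : MeasurableSpace Ω}
    [NormedAddCommGroup B] [NormedSpace ℝ B] [CompleteSpace B] {P : Measure Ω}
    [IsProbabilityMeasure P] {β : ℝ} (h : IsSmoothSpace B β) (hβ : 1 ≤ β) {ℱ : Filtration ℕ mΩ}
    {ξ : ℕ → Ω → B} {k T : ℕ} {σ α : ℝ} (hkT : k ≤ T) (hσ : 0 ≤ σ) (hα : 0 < α)
    (hξm : ∀ n, k < n → StronglyMeasurable[ℱ n] (ξ n))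
    (hξ : ∀ n, k < n → ∀ᵐ ω ∂P, ‖ξ n ω‖ ≤ 1 / (2 * β))
    (hξ0 : ∀ n, k < n → P[ξ n | ℱ (n - 1)] =ᵐ[P] 0)
    (hξσ : ∀ n, k < n → P[fun ω => ‖ξ n ω‖ ^ 2 | ℱ (n - 1)] ≤ᵐ[P] fun _ => σ) :
    P {ω | ∃ n, k ≤ n ∧ n ≤ T ∧
        1 + Real.log (1 / α) + 4 * β ^ 2 * σ * ((T : ℝ) - k) < ‖∑ i ∈ Finset.Ioc k n, ξ i ω‖}
      ≤ ENNReal.ofReal α := by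
  let S : ℕ → Ω → B := fun n ω => ∑ i ∈ Finset.Ioc k n, ξ i ω
  let V : ℕ → ℝ := fun n => 4 * β ^ 2 * σ * ((n : ℝ) - k)
  let W : ℕ → Ω → ℝ := fun n ω => Real.exp (-V n) * potential (S n ω)
  have hSm : ∀ n, StronglyMeasurable[ℱ n] (S n) := fun n =>
    Finset.stronglyMeasurable_fun_sum _ fun i hi => by
      rw [Finset.mem_Ioc] at hi
      exact (hξm i hi.1).mono (ℱ.mono hi.2)
  have hSb : ∀ n, ∀ᵐ ω ∂P, ‖S n ω‖ ≤ ∑ i ∈ Finset.Ioc k n, 1 / (2 * β) := by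
    intro n
    have : ∀ᵐ ω ∂P, ∀ i ∈ Finset.Ioc k n, ‖ξ i ω‖ ≤ 1 / (2 * β) := by
      rw [eventually_all_finset]
      exact fun i hi => hξ i (Finset.mem_Ioc.1 hi).1
    filter_upwards [this] with ω hω
    exact norm_sum_le_of_le _ hω
  have hWm : ∀ n, StronglyMeasurable[ℱ n] (W n) := fun n =>
    (continuous_potential.comp_stronglyMeasurable (hSm n)).const_mul _
  have hpint : ∀ n, Integrable (fun ω => potential (S n ω)) P := by
    intro n
    refine Integrable.of_bound ((continuous_potential.comp_stronglyMeasurable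
      (hSm n)).mono (ℱ.le n)).aestronglyMeasurable
      (Real.exp (√(1 + (∑ i ∈ Finset.Ioc k n, 1 / (2 * β)) ^ 2))) ?_
    filter_upwards [hSb n] with ω hω
    rw [Real.norm_of_nonneg (potential_pos _).le]
    exact potential_le hω
  have hWint : ∀ n, Integrable (W n) P := fun n => (hpint n).const_mul _
  have hstep : ∀ n, k ≤ n → P[W (n + 1) | ℱ n] ≤ᵐ[P] W n := by
    intro n hn
    have hkn : k < n + 1 := by omega
    have h1 := h.condExp_potential_le hβ (ℱ.le n) (hSm n) (hSb n)
      ((hξm _ hkn).mono (ℱ.le _)).aestronglyMeasurable (hξ _ hkn)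
      (by simpa using hξ0 _ hkn) (by simpa using hξσ _ hkn)
    have h2 : W (n + 1) = Real.exp (-V (n + 1)) •
        fun ω => potential (S n ω + ξ (n + 1) ω) := by
      funext ω
      simp only [W, S, Pi.smul_apply, smul_eq_mul]
      rw [Finset.sum_Ioc_succ_top hn]
    have h3 := condExp_smul (μ := P) (Real.exp (-V (n + 1)))
      (fun ω => potential (S n ω + ξ (n + 1) ω)) (ℱ n)
    rw [h2]
    filter_upwards [h1, h3] with ω h4 h5
    rw [h5, Pi.smul_apply, smul_eq_mul]
    calc _ ≤ Real.exp (-V (n + 1)) * (potential (S n ω) * Real.exp (4 * β ^ 2 * σ)) := by gcongr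
      _ = Real.exp (-V (n + 1)) * Real.exp (4 * β ^ 2 * σ) * potential (S n ω) := by ring
      _ = W n ω := by
        rw [← Real.exp_add]
        simp only [W, V]
        congr 2
        push_cast
        ring
  -- `W` starts at `e`, the potential at `0`, so level `e / α` is reached with probability at most
  -- `α`; this is the source of `1 + log (1 / α)`.
  have hmax := maximal_ineq_of_condExp_le (fun n _ => hWm n) (fun n _ => hWint n)
    (fun n ω => by have := potential_pos (S n ω); positivity) hstep (Real.exp 1 / α) hkT
  have hW0 : ∫ ω, W k ω ∂P = Real.exp 1 := by
    simp [W, V, S, potential_zero]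
  rw [hW0] at hmax
  have hle : P.real {ω | ∃ n, k ≤ n ∧ n ≤ T ∧ Real.exp 1 / α ≤ W n ω} ≤ α := by
    rw [div_mul_eq_mul_div, div_le_iff₀ hα] at hmax
    exact le_of_mul_le_mul_left hmax (Real.exp_pos 1)
  refine le_trans (measure_mono ?_) (ENNReal.le_ofReal_iff_toReal_le (measure_ne_top _ _) hα.le
    |>.2 hle)
  rintro ω ⟨n, h1, h2, h3⟩
  refine ⟨n, h1, h2, ?_⟩
  have hnT : (n : ℝ) ≤ T := by exact_mod_cast h2
  have hV : V n ≤ 4 * β ^ 2 * σ * ((T : ℝ) - k) := by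
    simp only [V]; gcongr
  calc Real.exp 1 / α = Real.exp (1 + Real.log (1 / α)) := by
        rw [Real.exp_add, Real.exp_log (by positivity)]; ring
    _ ≤ Real.exp (-V n + ‖S n ω‖) := by
        refine Real.exp_le_exp.2 ?_
        change 1 + Real.log (1 / α) ≤ -V n + ‖∑ i ∈ Finset.Ioc k n, ξ i ω‖
        linarith
    _ ≤ W n ω := by
        rw [Real.exp_add]
        simp only [W]
        gcongr
        exact exp_norm_le_potential _

/-! ### Pointwise estimates for truncation. -/

section Trunc

variable {B : Type*} [NormedAddCommGroup B]

theorem trunc_eq_inv_max (x : B) : trunc x = (max 1 ‖x‖)⁻¹ := by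
  unfold trunc
  split_ifs with h
  · simp [h]
  · have hx : 0 < ‖x‖ := norm_pos_iff.2 h
    rcases le_total ‖x‖ 1 with h1 | h1
    · rw [min_eq_right h1, max_eq_left h1, div_self hx.ne', inv_one]
    · rw [min_eq_left h1, max_eq_right h1, one_div]

theorem continuous_trunc : Continuous (trunc : B → ℝ) := by
  have : (trunc : B → ℝ) = fun x => (max 1 ‖x‖)⁻¹ := funext trunc_eq_inv_max
  rw [this]
  exact Continuous.inv₀ (by fun_prop) fun x =>
    (lt_of_lt_of_le one_pos (le_max_left (1 : ℝ) ‖x‖)).ne'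

variable [NormedSpace ℝ B] {lam p : ℝ}

theorem norm_trunc_smul (hl : 0 < lam) (u : B) :
    ‖trunc (lam • u) • u‖ = (max 1 (lam * ‖u‖))⁻¹ * ‖u‖ := by
  have : (0 : ℝ) < max 1 (lam * ‖u‖) := lt_of_lt_of_le one_pos (le_max_left _ _)
  rw [norm_smul, trunc_eq_inv_max, norm_smul, Real.norm_of_nonneg hl.le,
    Real.norm_of_nonneg (by positivity)]

theorem norm_trunc_smul_le (hl : 0 < lam) (u : B) : ‖trunc (lam • u) • u‖ ≤ 1 / lam := by
  have : (0 : ℝ) < max 1 (lam * ‖u‖) := lt_of_lt_of_le one_pos (le_max_left _ _)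
  rw [norm_trunc_smul hl, inv_mul_le_iff₀ this, mul_one_div, le_div_iff₀ hl, mul_comm]
  exact le_max_right _ _

/-- With `t = lam ‖u‖` this is `min(1, t)² ≤ t^p`, valid for every `p` in `[0, 2]`. -/
theorem norm_trunc_smul_sq_le (hl : 0 < lam) (hp0 : 0 ≤ p) (hp : p ≤ 2) (u : B) :
    ‖trunc (lam • u) • u‖ ^ 2 ≤ lam ^ p / lam ^ 2 * ‖u‖ ^ p := by
  have h0 : (0 : ℝ) < max 1 (lam * ‖u‖) := lt_of_lt_of_le one_pos (le_max_left _ _)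
  have ht : 0 ≤ lam * ‖u‖ := by positivity
  have key : ((max 1 (lam * ‖u‖))⁻¹ * (lam * ‖u‖)) ^ 2 ≤ (lam * ‖u‖) ^ p := by
    rcases le_total (lam * ‖u‖) 1 with h1 | h1
    · rw [max_eq_left h1, inv_one, one_mul, ← Real.rpow_two]
      exact Real.rpow_le_rpow_of_exponent_ge' ht h1 hp0 hp
    · rw [max_eq_right h1, inv_mul_cancel₀ (by positivity), one_pow]
      exact Real.one_le_rpow h1 hp0
  rw [Real.mul_rpow hl.le (norm_nonneg _)] at key
  rw [norm_trunc_smul hl, div_mul_eq_mul_div, le_div_iff₀ (by positivity)]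
  calc _ = ((max 1 (lam * ‖u‖))⁻¹ * (lam * ‖u‖)) ^ 2 := by ring
    _ ≤ _ := key

/-- Nothing is cut off when `lam ‖u‖ ≤ 1`; otherwise the error is at most `‖u‖`, and `(lam
‖u‖)^(p-1) ≥ 1`. -/
theorem norm_trunc_smul_sub_le (hl : 0 < lam) (hp : 1 ≤ p) (u : B) :
    ‖trunc (lam • u) • u - u‖ ≤ lam ^ (p - 1) * ‖u‖ ^ p := by
  have h0 : trunc (lam • u) • u - u = (trunc (lam • u) - 1) • u := by rw [sub_smul, one_smul]
  rw [h0, norm_smul, trunc_eq_inv_max, norm_smul, Real.norm_of_nonneg hl.le]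
  rcases le_total (lam * ‖u‖) 1 with h1 | h1
  · rw [max_eq_left h1, inv_one, sub_self, norm_zero, zero_mul]
    positivity
  · rw [max_eq_right h1]
    have hu : 0 < ‖u‖ := by
      by_contra! h2
      nlinarith [norm_nonneg u]
    have h2 : ‖(lam * ‖u‖)⁻¹ - 1‖ ≤ 1 := by
      have h3 : (lam * ‖u‖)⁻¹ ≤ 1 := inv_le_one_of_one_le₀ h1
      have h4 : 0 ≤ (lam * ‖u‖)⁻¹ := by positivity
      rw [Real.norm_eq_abs, abs_le]
      constructor <;> linarith
    calc ‖(lam * ‖u‖)⁻¹ - 1‖ * ‖u‖ ≤ 1 * ‖u‖ := by gcongr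
      _ ≤ (lam * ‖u‖) ^ (p - 1) * ‖u‖ := by
        gcongr
        exact Real.one_le_rpow h1 (by linarith)
      _ = _ := by
        rw [Real.mul_rpow hl.le hu.le, Real.rpow_sub_one hu.ne' p]
        field_simp

theorem integrable_trunc_smul {Ω : Type*} {mΩ : MeasurableSpace Ω} {P : Measure Ω}
    [IsFiniteMeasure P] {X : Ω → B} (hl : 0 < lam) (hX : AEStronglyMeasurable X P) :
    Integrable (fun ω => trunc (lam • X ω) • X ω) P :=
  Integrable.of_bound ((continuous_trunc.comp_aestronglyMeasurable (hX.const_smul lam)).smul hX)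
    (1 / lam) (ae_of_all _ fun _ => norm_trunc_smul_le hl _)

end Trunc

/-! ### Conditional bias and variance of a truncated observation. -/

section Step

variable {Ω B : Type*} {m₀ mΩ : MeasurableSpace Ω} [NormedAddCommGroup B] [NormedSpace ℝ B]
  [CompleteSpace B] {P : Measure Ω} [IsProbabilityMeasure P] {X Z : Ω → B} {m : B} {p v ρ lam : ℝ}

/-- Recentring at `Z` costs the convexity factor `2^(p-1)`, at most 2. -/
theorem condExp_rpow_norm_sub_le {B : Type*} [NormedAddCommGroup B] {X Z : Ω → B} {m : B}
    (hm : m₀ ≤ mΩ) (hp1 : 1 ≤ p) (hp2 : p ≤ 2)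
    (hX : AEStronglyMeasurable X P) (hZ : StronglyMeasurable[m₀] Z) (hZρ : ∀ ω, ‖Z ω - m‖ ≤ ρ)
    (hint : Integrable (fun ω => ‖X ω - m‖ ^ p) P)
    (hmom : P[fun ω => ‖X ω - m‖ ^ p | m₀] ≤ᵐ[P] fun _ => v) :
    Integrable (fun ω => ‖X ω - Z ω‖ ^ p) P ∧
      P[fun ω => ‖X ω - Z ω‖ ^ p | m₀] ≤ᵐ[P] fun _ => 2 * (v + ρ ^ p) := by
  have hZm : AEStronglyMeasurable Z P := (hZ.mono hm).aestronglyMeasurable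
  have hle : ∀ ω, ‖X ω - Z ω‖ ^ p ≤ 2 * (‖X ω - m‖ ^ p + ρ ^ p) := fun ω => by
    have h1 : ‖X ω - Z ω‖ ≤ ‖X ω - m‖ + ρ := by
      have : X ω - Z ω = (X ω - m) - (Z ω - m) := by abel
      rw [this]
      exact (norm_sub_le _ _).trans (by linarith [hZρ ω])
    have hρ : 0 ≤ ρ := (norm_nonneg _).trans (hZρ ω)
    calc ‖X ω - Z ω‖ ^ p ≤ (‖X ω - m‖ + ρ) ^ p := by gcongr
      _ ≤ 2 ^ (p - 1) * (‖X ω - m‖ ^ p + ρ ^ p) := by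
        exact_mod_cast NNReal.rpow_add_le_mul_rpow_add_rpow ⟨_, norm_nonneg (X ω - m)⟩ ⟨ρ, hρ⟩ hp1
      _ ≤ 2 ^ (1 : ℝ) * (‖X ω - m‖ ^ p + ρ ^ p) := by
        gcongr
        · norm_num
        · linarith
      _ = _ := by rw [Real.rpow_one]
  have hbig : Integrable (fun ω => 2 * (‖X ω - m‖ ^ p + ρ ^ p)) P :=
    (hint.add (integrable_const _)).const_mul 2
  have hi : Integrable (fun ω => ‖X ω - Z ω‖ ^ p) P := by
    refine hbig.mono' ((hX.sub hZm).norm.aemeasurable.pow_const p).aestronglyMeasurable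
      (ae_of_all _ fun ω => ?_)
    rw [Real.norm_of_nonneg (by positivity)]
    exact hle ω
  refine ⟨hi, ?_⟩
  have h1 := condExp_mono (m := m₀) hi hbig (ae_of_all _ hle)
  have h2 := condExp_smul (μ := P) (2 : ℝ) ((fun ω => ‖X ω - m‖ ^ p) + fun _ => ρ ^ p) m₀
  have h3 := condExp_add hint (integrable_const (μ := P) (ρ ^ p)) m₀
  have h4 : P[fun _ : Ω => ρ ^ p | m₀] = fun _ => ρ ^ p := condExp_const hm _
  filter_upwards [h1, h2, h3, hmom] with ω h5 h6 h7 h8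
  refine h5.trans ?_
  change P[(2 : ℝ) • ((fun ω => ‖X ω - m‖ ^ p) + fun _ => ρ ^ p) | m₀] ω ≤ _
  rw [h6, Pi.smul_apply, h7, Pi.add_apply, h4, smul_eq_mul]
  linarith

/-- The conditional bias of a truncated observation. -/
theorem norm_condExp_trunc_sub_le (hm : m₀ ≤ mΩ) (hl : 0 < lam) (hp1 : 1 ≤ p) (hp2 : p ≤ 2)
    (hX : Integrable X P) (hZ : StronglyMeasurable[m₀] Z) (hZρ : ∀ ω, ‖Z ω - m‖ ≤ ρ)
    (hmean : P[X | m₀] =ᵐ[P] fun _ => m)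
    (hint : Integrable (fun ω => ‖X ω - m‖ ^ p) P)
    (hmom : P[fun ω => ‖X ω - m‖ ^ p | m₀] ≤ᵐ[P] fun _ => v) :
    ∀ᵐ ω ∂P, ‖P[fun ω => trunc (lam • (X ω - Z ω)) • (X ω - Z ω) | m₀] ω - (m - Z ω)‖
      ≤ 2 * lam ^ (p - 1) * (v + ρ ^ p) := by
  obtain ⟨hi, hc⟩ := condExp_rpow_norm_sub_le hm hp1 hp2 hX.1 hZ hZρ hint hmom
  have hZi : Integrable Z P := by
    refine Integrable.of_bound (hZ.mono hm).aestronglyMeasurable (ρ + ‖m‖) (ae_of_all _ fun ω => ?_)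
    calc ‖Z ω‖ = ‖(Z ω - m) + m‖ := by rw [sub_add_cancel]
      _ ≤ _ := (norm_add_le _ _).trans (by linarith [hZρ ω])
  have hU : Integrable (X - Z) P := hX.sub hZi
  have hY : Integrable (fun ω => trunc (lam • (X ω - Z ω)) • (X ω - Z ω)) P :=
    integrable_trunc_smul hl hU.1
  -- As `Z` is `m₀`-measurable, `E[X - Z | m₀] = m - Z`: the bias is the conditional mean of the
  -- truncation error.
  have h1 := condExp_sub hY hU m₀
  have h2 := condExp_sub hX hZi m₀
  have h3 := condExp_of_stronglyMeasurable hm hZ hZi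
  have h4 := norm_condExp_le (μ := P) (m := m₀)
    ((fun ω => trunc (lam • (X ω - Z ω)) • (X ω - Z ω)) - (X - Z))
  have h5 := condExp_mono (m := m₀) (hY.sub hU).norm (hi.smul (lam ^ (p - 1)))
    (ae_of_all _ fun ω => norm_trunc_smul_sub_le hl hp1 (X ω - Z ω))
  have h6 := condExp_smul (μ := P) (lam ^ (p - 1)) (fun ω => ‖X ω - Z ω‖ ^ p) m₀
  filter_upwards [h1, h2, h4, h5, h6, hc, hmean] with ω g1 g2 g4 g5 g6 g7 g8
  rw [Pi.sub_apply, g2, Pi.sub_apply, h3, g8] at g1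
  rw [← g1]
  refine g4.trans (g5.trans ?_)
  rw [g6, Pi.smul_apply, smul_eq_mul]
  calc _ ≤ lam ^ (p - 1) * (2 * (v + ρ ^ p)) := by gcongr
    _ = _ := by ring

/-- The conditional variance of a truncated observation. -/
theorem condExp_norm_trunc_sub_sq_le (hm : m₀ ≤ mΩ) (hl : 0 < lam) (hp1 : 1 ≤ p) (hp2 : p ≤ 2)
    (hX : AEStronglyMeasurable X P) (hZ : StronglyMeasurable[m₀] Z) (hZρ : ∀ ω, ‖Z ω - m‖ ≤ ρ)
    (hint : Integrable (fun ω => ‖X ω - m‖ ^ p) P)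
    (hmom : P[fun ω => ‖X ω - m‖ ^ p | m₀] ≤ᵐ[P] fun _ => v) :
    P[fun ω => ‖trunc (lam • (X ω - Z ω)) • (X ω - Z ω) -
        P[fun ω => trunc (lam • (X ω - Z ω)) • (X ω - Z ω) | m₀] ω‖ ^ 2 | m₀]
      ≤ᵐ[P] fun _ => 8 * (lam ^ p / lam ^ 2) * (v + ρ ^ p) := by
  obtain ⟨hi, hc⟩ := condExp_rpow_norm_sub_le hm hp1 hp2 hX hZ hZρ hint hmom
  set Y : Ω → B := fun ω => trunc (lam • (X ω - Z ω)) • (X ω - Z ω) with hYdef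
  have hY : Integrable Y P := integrable_trunc_smul hl (hX.sub (hZ.mono hm).aestronglyMeasurable)
  have hYm := hY.1
  have hYb : ∀ ω, ‖Y ω‖ ≤ 1 / lam := fun ω => norm_trunc_smul_le hl _
  have hY2 : Integrable (fun ω => ‖Y ω‖ ^ 2) P := by
    refine Integrable.of_bound (by fun_prop) ((1 / lam) ^ 2) (ae_of_all _ fun ω => ?_)
    rw [norm_pow, norm_norm]
    have := hYb ω
    gcongr
  have hEm : StronglyMeasurable[m₀] (P[Y | m₀]) := stronglyMeasurable_condExp
  have hEb : ∀ᵐ ω ∂P, ‖P[Y | m₀] ω‖ ≤ 1 / lam :=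
    ae_bdd_norm_condExp_of_ae_bdd_norm (ae_of_all _ hYb)
  have hE2m : StronglyMeasurable[m₀] fun ω => ‖P[Y | m₀] ω‖ ^ 2 := hEm.norm.pow 2
  have hE2 : Integrable (fun ω => ‖P[Y | m₀] ω‖ ^ 2) P := by
    refine Integrable.of_bound (hE2m.mono hm).aestronglyMeasurable ((1 / lam) ^ 2) ?_
    filter_upwards [hEb] with ω hω
    rw [norm_pow, norm_norm]
    gcongr
  have hD2 : Integrable (fun ω => ‖Y ω - P[Y | m₀] ω‖ ^ 2) P := by
    refine Integrable.of_bound ((hYm.sub (hEm.mono hm).aestronglyMeasurable).norm.pow 2)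
      ((1 / lam + 1 / lam) ^ 2) ?_
    filter_upwards [hEb] with ω hω
    rw [norm_pow, norm_norm]
    gcongr
    exact (norm_sub_le _ _).trans (add_le_add (hYb ω) hω)
  -- In place of the Hilbert-space variance identity: `‖a - b‖² ≤ 2‖a‖² + 2‖b‖²` and Jensen bound
  -- the variance by four times the second moment. Recentring doubles this to the factor 8.
  have hjensen : (fun ω => ‖P[Y | m₀] ω‖ ^ 2) ≤ᵐ[P] P[fun ω => ‖Y ω‖ ^ 2 | m₀] :=
    ConvexOn.map_condExp_le_univ (φ := fun x : B => ‖x‖ ^ 2) hm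
      (convexOn_univ_norm.pow (fun x _ => norm_nonneg x) 2)
      (Continuous.lowerSemicontinuous (by fun_prop)) hY hY2
  have h1 := condExp_mono (m := m₀) hD2
    ((hY2.smul (2 : ℝ)).add (hE2.smul (2 : ℝ))) (ae_of_all _ fun ω => by
      have h1 := norm_sub_le (Y ω) (P[Y | m₀] ω)
      have h2 : ‖Y ω - P[Y | m₀] ω‖ ^ 2 ≤ (‖Y ω‖ + ‖P[Y | m₀] ω‖) ^ 2 := by gcongr
      simp only [Pi.add_apply, Pi.smul_apply, smul_eq_mul]
      nlinarith [sq_nonneg (‖Y ω‖ - ‖P[Y | m₀] ω‖)])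
  have h2 := condExp_add (hY2.smul (2 : ℝ)) (hE2.smul (2 : ℝ)) m₀
  have h3 := condExp_smul (μ := P) (2 : ℝ) (fun ω => ‖Y ω‖ ^ 2) m₀
  have h4 : P[(2 : ℝ) • (fun ω => ‖P[Y | m₀] ω‖ ^ 2) | m₀] =
      (2 : ℝ) • (fun ω => ‖P[Y | m₀] ω‖ ^ 2) :=
    condExp_of_stronglyMeasurable hm (hE2m.const_smul 2) (hE2.smul 2)
  have h5 := condExp_mono (m := m₀) hY2 (hi.smul (lam ^ p / lam ^ 2))
    (ae_of_all _ fun ω => norm_trunc_smul_sq_le hl (by linarith) hp2 (X ω - Z ω))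
  have h6 := condExp_smul (μ := P) (lam ^ p / lam ^ 2) (fun ω => ‖X ω - Z ω‖ ^ p) m₀
  filter_upwards [h1, h2, h3, h5, h6, hc, hjensen] with ω g1 g2 g3 g5 g6 g7 g8
  rw [g2, Pi.add_apply, g3, h4] at g1
  rw [g6] at g5
  simp only [Pi.smul_apply, smul_eq_mul] at g1 g5
  have g9 : lam ^ p / lam ^ 2 * P[fun ω => ‖X ω - Z ω‖ ^ p | m₀] ω
      ≤ lam ^ p / lam ^ 2 * (2 * (v + ρ ^ p)) := by gcongr
  linarith

end Step

/-! ### Concentration of the truncated sum. -/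

/-- Time-uniform bound, over a finite time range, for the sum of truncated observations centered at
a preliminary estimate. -/
theorem IsSmoothSpace.measure_norm_trunc_sum_gt_le {Ω B : Type*} {mΩ : MeasurableSpace Ω}
    [NormedAddCommGroup B] [NormedSpace ℝ B] [CompleteSpace B] {P : Measure Ω}
    [IsProbabilityMeasure P] {β p v ρ lam α : ℝ} (h : IsSmoothSpace B β) (hβ : 1 ≤ β)
    {ℱ : Filtration ℕ mΩ} {X : ℕ → Ω → B} {m : B} (hA : MeanAssumption P ℱ X m p v)
    (hp1 : 1 ≤ p) (hp2 : p ≤ 2) (hv : 0 ≤ v) (hρ : 0 ≤ ρ) (hl : 0 < lam) {k T : ℕ} (hkT : k ≤ T)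
    (hα : 0 < α) {Z : Ω → B} (hZ : StronglyMeasurable[ℱ k] Z)
    (hPZ : P {ω | ρ ≤ ‖Z ω - m‖} ≤ ENNReal.ofReal α) :
    P {ω | ∃ n, k ≤ n ∧ n ≤ T ∧
        4 * β / lam * (1 + Real.log (1 / α) + 2 * lam ^ p * (v + ρ ^ p) * ((T : ℝ) - k)) +
          ((n : ℝ) - k) * (2 * lam ^ (p - 1) * (v + ρ ^ p)) <
        ‖∑ i ∈ Finset.Ioc k n, (trunc (lam • (X i ω - Z ω)) • (X i ω - Z ω) + Z ω - m)‖}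
      ≤ ENNReal.ofReal (2 * α) := by
  classical
  -- On the event where the initial estimate is bad it is replaced by the true mean. The error is
  -- then at most `ρ` everywhere, `ℱ k`-measurability is kept, and only an event of probability `α`
  -- is lost.
  let Z' : Ω → B := fun ω => if ρ ≤ ‖Z ω - m‖ then m else Z ω
  have hZ' : StronglyMeasurable[ℱ k] Z' :=
    StronglyMeasurable.ite (stronglyMeasurable_const.measurableSet_le
      ((hZ.sub stronglyMeasurable_const).norm)) stronglyMeasurable_const hZ
  have hZ'ρ : ∀ ω, ‖Z' ω - m‖ ≤ ρ := fun ω => by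
    by_cases hω : ρ ≤ ‖Z ω - m‖
    · simpa [Z', hω] using hρ
    · simpa [Z', hω] using (not_le.1 hω).le
  let Y : ℕ → Ω → B := fun n ω => trunc (lam • (X n ω - Z' ω)) • (X n ω - Z' ω)
  have hQ : 0 ≤ v + ρ ^ p := by positivity
  have hZn : ∀ n, k < n → StronglyMeasurable[ℱ (n - 1)] Z' := fun n hn =>
    hZ'.mono (ℱ.mono (by omega))
  have hYm : ∀ n, k < n → StronglyMeasurable[ℱ n] (Y n) := fun n hn => by
    have hU := (hA.adapted n (by omega)).sub (hZ'.mono (ℱ.mono hn.le))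
    exact (continuous_trunc.comp_stronglyMeasurable (hU.const_smul lam)).smul hU
  have hYi : ∀ n, k < n → Integrable (Y n) P := fun n hn =>
    integrable_trunc_smul hl (((hA.adapted n (by omega)).sub
      (hZ'.mono (ℱ.mono hn.le))).mono (ℱ.le n)).aestronglyMeasurable
  have hYb : ∀ n ω, ‖Y n ω‖ ≤ 1 / lam := fun n ω => norm_trunc_smul_le hl _
  -- Centred terms have norm at most `2 / lam`; this scaling brings them to the admissible size `1 /
  -- (2β)`. The variance proxy `σ` then makes `4β²σ = 2 lam^p (v + ρ^p)` free of `β`.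
  let ξ : ℕ → Ω → B := fun n => (lam / (4 * β)) • (Y n - P[Y n | ℱ (n - 1)])
  have hξm : ∀ n, k < n → StronglyMeasurable[ℱ n] (ξ n) := fun n hn =>
    ((hYm n hn).sub (stronglyMeasurable_condExp.mono (ℱ.mono (by omega)))).const_smul _
  have hξ : ∀ n, k < n → ∀ᵐ ω ∂P, ‖ξ n ω‖ ≤ 1 / (2 * β) := fun n hn => by
    have hb : ∀ᵐ ω ∂P, ‖P[Y n | ℱ (n - 1)] ω‖ ≤ 1 / lam :=
      ae_bdd_norm_condExp_of_ae_bdd_norm (ae_of_all _ (hYb n))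
    filter_upwards [hb] with ω hω
    simp only [ξ, Pi.smul_apply, Pi.sub_apply]
    rw [norm_smul, Real.norm_of_nonneg (by positivity)]
    calc _ ≤ lam / (4 * β) * (1 / lam + 1 / lam) := by
          gcongr
          exact (norm_sub_le _ _).trans (add_le_add (hYb n ω) hω)
      _ = _ := by field_simp; norm_num
  have hξ0 : ∀ n, k < n → P[ξ n | ℱ (n - 1)] =ᵐ[P] 0 := fun n hn => by
    have h1 := condExp_smul (μ := P) (lam / (4 * β)) (Y n - P[Y n | ℱ (n - 1)]) (ℱ (n - 1))
    have h2 := condExp_sub (hYi n hn) (integrable_condExp (μ := P) (m := ℱ (n - 1)) (f := Y n))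
      (ℱ (n - 1))
    have h3 : P[P[Y n | ℱ (n - 1)] | ℱ (n - 1)] = P[Y n | ℱ (n - 1)] :=
      condExp_of_stronglyMeasurable (ℱ.le _) stronglyMeasurable_condExp integrable_condExp
    filter_upwards [h1, h2] with ω g1 g2
    rw [g1, Pi.smul_apply, g2, Pi.sub_apply, h3, sub_self, smul_zero, Pi.zero_apply]
  have hξσ : ∀ n, k < n → P[fun ω => ‖ξ n ω‖ ^ 2 | ℱ (n - 1)] ≤ᵐ[P]
      fun _ => lam ^ p * (v + ρ ^ p) / (2 * β ^ 2) := fun n hn => by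
    have h1 := condExp_norm_trunc_sub_sq_le (ℱ.le (n - 1)) hl hp1 hp2
      (hA.integrable n (by omega)).1 (hZn n hn) hZ'ρ (hA.integrable_moment n (by omega))
      (hA.cond_moment n (by omega))
    have h2 : (fun ω => ‖ξ n ω‖ ^ 2) =
        (lam / (4 * β)) ^ 2 • fun ω => ‖Y n ω - P[Y n | ℱ (n - 1)] ω‖ ^ 2 := by
      funext ω
      simp only [ξ, Pi.smul_apply, Pi.sub_apply, norm_smul, smul_eq_mul, mul_pow]
      rw [Real.norm_of_nonneg (by positivity)]
    have h3 := condExp_smul (μ := P) ((lam / (4 * β)) ^ 2)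
      (fun ω => ‖Y n ω - P[Y n | ℱ (n - 1)] ω‖ ^ 2) (ℱ (n - 1))
    rw [h2]
    filter_upwards [h1, h3] with ω g1 g3
    rw [g3, Pi.smul_apply, smul_eq_mul]
    calc _ ≤ (lam / (4 * β)) ^ 2 * (8 * (lam ^ p / lam ^ 2) * (v + ρ ^ p)) := by gcongr
      _ = _ := by field_simp; ring
  have hconc := h.measure_norm_sum_gt_le hβ hkT
    (σ := lam ^ p * (v + ρ ^ p) / (2 * β ^ 2)) (by positivity) hα hξm hξ hξ0 hξσ
  have hbias : ∀ᵐ ω ∂P, ∀ i, k < i → ‖P[Y i | ℱ (i - 1)] ω - (m - Z' ω)‖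
      ≤ 2 * lam ^ (p - 1) * (v + ρ ^ p) := by
    refine ae_all_iff.2 fun i => ?_
    by_cases hi : k < i
    · filter_upwards [norm_condExp_trunc_sub_le (ℱ.le (i - 1)) hl hp1 hp2
        (hA.integrable i (by omega)) (hZn i hi) hZ'ρ (hA.cond_mean i (by omega))
        (hA.integrable_moment i (by omega)) (hA.cond_moment i (by omega))] with ω hω _
      exact hω
    · exact ae_of_all _ fun ω h' => absurd h' hi
  have h0 := ae_iff.1 hbias
  refine (measure_mono (fun ω hω => ?_)).trans ((measure_union_le _ _).trans
    (add_le_add ((measure_union_le _ _).trans (add_le_add hPZ hconc)) h0.le) |>.trans ?_)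
  · by_contra hcon
    simp only [Set.mem_union, not_or, Set.mem_ofPred_eq, not_not, not_exists, not_and,
      not_lt] at hcon
    obtain ⟨⟨c1, c2⟩, c3⟩ := hcon
    obtain ⟨n, hn1, hn2, hn3⟩ := hω
    have hZZ : Z' ω = Z ω := by simp [Z', c1]
    refine absurd hn3 (not_lt.2 ?_)
    have hsplit : ∑ i ∈ Finset.Ioc k n, (trunc (lam • (X i ω - Z ω)) • (X i ω - Z ω) + Z ω - m) =
        (4 * β / lam) • ∑ i ∈ Finset.Ioc k n, ξ i ω +
          ∑ i ∈ Finset.Ioc k n, (P[Y i | ℱ (i - 1)] ω - (m - Z' ω)) := by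
      rw [Finset.smul_sum, ← Finset.sum_add_distrib]
      refine Finset.sum_congr rfl fun i _ => ?_
      simp only [ξ, Pi.smul_apply, Pi.sub_apply, smul_smul]
      have : 4 * β / lam * (lam / (4 * β)) = 1 := by field_simp
      rw [this, one_smul, ← hZZ]
      simp only [Y]
      abel
    rw [hsplit]
    refine (norm_add_le _ _).trans (add_le_add ?_ ?_)
    · rw [norm_smul, Real.norm_of_nonneg (by positivity)]
      gcongr
      refine (c2 n hn1 hn2).trans (le_of_eq ?_)
      have hβ0 : β ≠ 0 := by positivity
      field_simp
      ring
    · refine (norm_sum_le_of_le _ fun i hi => c3 i (Finset.mem_Ioc.1 hi).1).trans (le_of_eq ?_)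
      rw [Finset.sum_const, Nat.card_Ioc, nsmul_eq_mul, Nat.cast_sub hn1]
  · rw [add_zero, ← ENNReal.ofReal_add hα.le hα.le, two_mul]

/-! ### Deterministic estimates: stitching weights, constants, rates. -/

theorem hasSum_riemannZeta_re {s : ℝ} (hs : 1 < s) :
    HasSum (fun j : ℕ => 1 / ((j : ℝ) + 1) ^ s) (riemannZeta (s : ℂ)).re := by
  have hsum : Summable fun j : ℕ => 1 / ((j : ℝ) + 1) ^ s := by
    have h1 := (summable_nat_add_iff 1).2 (Real.summable_one_div_nat_rpow.2 hs)
    simpa using h1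
  have hz : riemannZeta (s : ℂ) = ((∑' j : ℕ, 1 / ((j : ℝ) + 1) ^ s : ℝ) : ℂ) := by
    rw [zeta_eq_tsum_one_div_nat_add_one_cpow (by simpa using hs), Complex.ofReal_tsum]
    refine tsum_congr fun j => ?_
    rw [Complex.ofReal_div, Complex.ofReal_cpow (by positivity)]
    simp
  rw [hz, Complex.ofReal_re]
  exact hsum.hasSum

theorem one_le_riemannZeta_re {s : ℝ} (hs : 1 < s) : 1 ≤ (riemannZeta (s : ℂ)).re := by
  have h := hasSum_riemannZeta_re hs
  simpa using le_hasSum h 0 fun j _ => by positivity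

theorem one_le_stitch {s : ℝ} (hs : 1 < s) (j : ℕ) : 1 ≤ stitch s j :=
  one_le_mul_of_one_le_of_one_le
    (Real.one_le_rpow (by linarith [Nat.cast_nonneg (α := ℝ) j]) (by linarith))
    (one_le_riemannZeta_re hs)

/-- The normalisation by `ζ(s)` lets the epochs share the failure budget `δ` in proportions `1 /
h(j)`. -/
theorem hasSum_inv_stitch {s : ℝ} (hs : 1 < s) : HasSum (fun j : ℕ => (stitch s j)⁻¹) 1 := by
  have hz : (riemannZeta (s : ℂ)).re ≠ 0 := by linarith [one_le_riemannZeta_re hs]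
  have h := (hasSum_riemannZeta_re hs).mul_right ((riemannZeta (s : ℂ)).re)⁻¹
  rw [mul_inv_cancel₀ hz] at h
  refine h.congr_fun fun j => ?_
  rw [stitch, mul_inv, one_div]

theorem Kconst_mem_Icc {p : ℝ} (hp : 1 < p) : Kconst p ∈ Set.Icc 0 1 := by
  have h0 : 0 ≤ (p - 1) / p := div_nonneg (by linarith) (by linarith)
  have h1 : (p - 1) / p ≤ 1 := (div_le_one (by linarith)).2 (by linarith)
  have h2 : 1 / p ≤ 1 := (div_le_one (by linarith)).2 hp.le
  have h3 : 0 ≤ 1 / p := by positivity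
  refine ⟨mul_nonneg h3 (Real.rpow_nonneg h0 _), mul_le_one₀ h2 (Real.rpow_nonneg h0 _) ?_⟩
  exact Real.rpow_le_one h0 h1 (by linarith)

/-- The bound `exp y ≤ 1 + y + y²` is used at `y = x / 2 ≤ 1` and squared. The range up to 2
suffices because `2 / β ≤ 2`. -/
theorem exp_sub_sub_one_le {x : ℝ} (h0 : 0 ≤ x) (h2 : x ≤ 2) :
    Real.exp x - x - 1 ≤ 2 * x ^ 2 := by
  have h1 := (abs_le.1 (Real.abs_exp_sub_one_sub_id_le (x := x / 2)
    (abs_le.2 ⟨by linarith, by linarith⟩))).2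
  have h3 : Real.exp x = Real.exp (x / 2) ^ 2 := by
    rw [← Real.exp_nat_mul]; congr 1; push_cast; ring
  have h4 : Real.exp (x / 2) ^ 2 ≤ (1 + x / 2 + (x / 2) ^ 2) ^ 2 := by
    gcongr; linarith
  rw [h3]
  nlinarith [mul_nonneg (sq_nonneg x) (sub_nonneg.2 h2), mul_nonneg (mul_nonneg (sq_nonneg x) h0)
    (sub_nonneg.2 h2)]

/-- The bounds cover both the Hilbert and the general case, which keeps the final constants
independent of the space. -/
theorem Cconst_mem_Icc (B : Type*) [NormedAddCommGroup B] {p β : ℝ} (hp1 : 1 < p) (hp2 : p ≤ 2)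
    (hβ : 1 ≤ β) : Cconst B p β ∈ Set.Icc (1 / 2) 16 := by
  have hx0 : 0 < 2 * β⁻¹ := by positivity
  have hx2 : 2 * β⁻¹ ≤ 2 := by linarith [inv_le_one_of_one_le₀ hβ]
  have hlo : 1 / 2 ≤ (Real.exp (2 * β⁻¹) - 2 * β⁻¹ - 1) / (2 * β⁻¹) ^ 2 := by
    rw [le_div_iff₀ (by positivity)]
    linarith [Real.quadratic_le_exp_of_nonneg hx0.le]
  have hup : (Real.exp (2 * β⁻¹) - 2 * β⁻¹ - 1) / (2 * β⁻¹) ^ 2 ≤ 2 := by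
    rw [div_le_iff₀ (by positivity)]
    exact exp_sub_sub_one_le hx0.le hx2
  have hc : ∀ e : ℝ, 0 ≤ e → e ≤ 3 → (1 : ℝ) ≤ 2 ^ e ∧ (2 : ℝ) ^ e ≤ 8 := fun e h0 h3 => by
    refine ⟨Real.one_le_rpow (by norm_num) h0, ?_⟩
    calc (2 : ℝ) ^ e ≤ 2 ^ (3 : ℝ) := Real.rpow_le_rpow_of_exponent_le (by norm_num) h3
      _ = 8 := by norm_num
  unfold Cconst
  split_ifs
  · obtain ⟨h1, h2⟩ := hc (p - 1) (by linarith) (by linarith)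
    constructor <;> nlinarith
  · obtain ⟨h1, h2⟩ := hc (p + 1) (by linarith) (by linarith)
    constructor <;> nlinarith

/-- The denominator constant of the truncation level is comparable to `β`. -/
theorem truncLevel_const_bounds (B : Type*) [NormedAddCommGroup B] {p β : ℝ} (hp1 : 1 < p)
    (hp2 : p ≤ 2) (hβ : 1 ≤ β) :
    β / 2 ≤ β * Cconst B p β + 2 ^ (p - 1) * Kconst p ∧
      β * Cconst B p β + 2 ^ (p - 1) * Kconst p ≤ 18 * β := by
  obtain ⟨c1, c2⟩ := Cconst_mem_Icc B hp1 hp2 hβ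
  obtain ⟨k1, k2⟩ := Kconst_mem_Icc hp1
  have h1 : (0 : ℝ) ≤ 2 ^ (p - 1) := by positivity
  have h2 : (2 : ℝ) ^ (p - 1) ≤ 2 := by
    calc (2 : ℝ) ^ (p - 1) ≤ 2 ^ (1 : ℝ) :=
          Real.rpow_le_rpow_of_exponent_le (by norm_num) (by linarith)
      _ = 2 := by norm_num
  have h3 : (2 : ℝ) ^ (p - 1) * Kconst p ≤ 2 * 1 := by gcongr
  have h4 := mul_nonneg h1 k1
  constructor <;> nlinarith

/-- The bias and deviation terms are balanced by the truncation level. -/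
theorem balanced_bound_le {p β E Q L w lam a l τ : ℝ} (hp1 : 1 < p) (hβ : 1 ≤ β)
    (hE1 : β / 2 ≤ E) (hE2 : E ≤ 18 * β) (hQ : 0 < Q) (hL : 1 ≤ L) (hw : 0 < w)
    (hlam : lam = (β * L / (w * (E * Q))) ^ (1 / p)) (ha : w / 2 ≤ a) (hl : l ≤ L)
    (hτ0 : 0 ≤ τ) (hτ : τ ≤ 2 * w) :
    a⁻¹ * (4 * β / lam * (1 + l + 2 * lam ^ p * Q * τ) + a * (2 * lam ^ (p - 1) * Q))
      ≤ 1444 * (β * (Q ^ (1 / p) * (L / w) ^ ((p - 1) / p))) := by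
  have hp0 : 0 < p := by linarith
  have hβ0 : 0 < β := by linarith
  have hE : 0 < E := by linarith
  have hL0 : 0 < L := by linarith
  have ha0 : 0 < a := by linarith
  set y := β * L / (w * (E * Q)) with hy
  have hy0 : 0 < y := by positivity
  have hlam0 : 0 < lam := by rw [hlam]; positivity
  have hlp : lam ^ p = y := by
    rw [hlam, ← Real.rpow_mul hy0.le, one_div_mul_cancel hp0.ne', Real.rpow_one]
  -- Since `E` is comparable to `β`, the factor `β` cancels in `lam^p = y`, which lies between `u /
  -- 18` and `2u`.
  set u := L / w / Q with hu
  have hu0 : 0 < u := by positivity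
  have hyu : y ≤ 2 * u := by
    rw [hy, hu, div_le_iff₀ (by positivity)]
    have : 2 * (L / w / Q) * (w * (E * Q)) = 2 * E * L := by field_simp
    rw [this]
    nlinarith
  have huy : u / 18 ≤ y := by
    rw [hy, hu, le_div_iff₀ (by positivity)]
    have : L / w / Q / 18 * (w * (E * Q)) = E * L / 18 := by field_simp
    rw [this]
    nlinarith
  have ht0 : 0 ≤ 1 / p := by positivity
  have ht1 : 1 / p ≤ 1 := (div_le_one hp0).2 hp1.le
  have hone : (p - 1) / p = 1 - 1 / p := by field_simp
  set t := 1 / p with ht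
  set F := Q ^ t * (L / w) ^ ((p - 1) / p) with hF
  have hF0 : 0 < F := by positivity
  have hx : L / w = Q * u := by rw [hu]; field_simp
  have hFu : F = Q * u ^ (1 - t) := by
    rw [hF, hone, hx, Real.mul_rpow hQ.le hu0.le, ← mul_assoc, ← Real.rpow_add hQ]
    norm_num
  have hFu' : F = Q * u / u ^ t := by
    rw [hFu, Real.rpow_sub hu0, Real.rpow_one, mul_div_assoc]
  have hlow : u ^ t / 18 ≤ lam := by
    have h1 : (18 : ℝ) ^ t ≤ 18 := by
      simpa using Real.rpow_le_rpow_of_exponent_le (by norm_num : (1 : ℝ) ≤ 18) ht1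
    calc u ^ t / 18 ≤ u ^ t / 18 ^ t := by gcongr
      _ = (u / 18) ^ t := (Real.div_rpow hu0.le (by norm_num) t).symm
      _ ≤ y ^ t := by gcongr
      _ = lam := hlam.symm
  have hbias : lam ^ (p - 1) ≤ 2 * u ^ (1 - t) := by
    have h1 : (2 : ℝ) ^ (1 - t) ≤ 2 := by
      simpa using Real.rpow_le_rpow_of_exponent_le (by norm_num : (1 : ℝ) ≤ 2)
        (by linarith : 1 - t ≤ 1)
    calc lam ^ (p - 1) = y ^ (1 - t) := by
          rw [hlam, ← Real.rpow_mul hy0.le, ← hone]; congr 1; rw [ht]; ring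
      _ ≤ (2 * u) ^ (1 - t) := Real.rpow_le_rpow hy0.le hyu (by linarith)
      _ = 2 ^ (1 - t) * u ^ (1 - t) := Real.mul_rpow (by norm_num) hu0.le
      _ ≤ _ := by gcongr
  have hin : 1 + l + 2 * lam ^ p * Q * τ ≤ 10 * L := by
    have h1 : 2 * lam ^ p * Q * τ ≤ 2 * (2 * u) * Q * (2 * w) := by
      rw [hlp]; gcongr
    have h2 : 2 * (2 * u) * Q * (2 * w) = 8 * L := by rw [hu]; field_simp; norm_num
    linarith
  -- The constant is `2 · 4 · 18 · 10`: from `a ≥ w / 2`, the prefactor `4β`, the lower bound on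
  -- `lam`, and `hin`. The bias adds 4.
  have hdev : a⁻¹ * (4 * β / lam * (1 + l + 2 * lam ^ p * Q * τ)) ≤ 1440 * (β * F) := by
    calc a⁻¹ * (4 * β / lam * (1 + l + 2 * lam ^ p * Q * τ))
        ≤ (w / 2)⁻¹ * (4 * β / (u ^ t / 18) * (10 * L)) := by
          have : 0 < u ^ t := by positivity
          have h1 : a⁻¹ ≤ (w / 2)⁻¹ := by gcongr
          have h2 : 4 * β / lam ≤ 4 * β / (u ^ t / 18) := by gcongr
          calc _ ≤ a⁻¹ * (4 * β / lam * (10 * L)) := by gcongr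
            _ ≤ _ := by gcongr
      _ = 1440 * (β * ((L / w) / u ^ t)) := by
          have : 0 < u ^ t := by positivity
          field_simp
          norm_num
      _ = _ := by rw [hFu', hx]
  have hb : a⁻¹ * (a * (2 * lam ^ (p - 1) * Q)) ≤ 4 * (β * F) := by
    rw [inv_mul_cancel_left₀ ha0.ne']
    calc 2 * lam ^ (p - 1) * Q ≤ 2 * (2 * u ^ (1 - t)) * Q := by gcongr
      _ = 4 * (1 * F) := by rw [hFu]; ring
      _ ≤ _ := by gcongr
  rw [mul_add]
  linarith

theorem one_lt_log_of_three_le {n : ℕ} (hn : 3 ≤ n) : 1 < Real.log n := by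
  have h3 : (3 : ℝ) ≤ n := by exact_mod_cast hn
  rw [Real.lt_log_iff_exp_lt (by linarith)]
  linarith [Real.exp_one_lt_d9]

/-- The epoch-wise confidence term is at most a multiple, depending only on `s`, of the iterated
logarithm. -/
theorem exists_log_stitch_le {s : ℝ} (hs : 1 < s) :
    ∃ c : ℝ, 1 ≤ c ∧ ∀ δ : ℝ, 0 < δ → δ < 1 → ∀ n : ℕ, 3 ≤ n →
      Real.log (4 * stitch s (Nat.log 2 n : ℝ) / δ) ≤ c * Real.log (Real.log n / δ) := by
  set z := (riemannZeta (s : ℂ)).re with hz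
  have hz1 : 1 ≤ z := one_le_riemannZeta_re hs
  have h31 : 1 < Real.log 3 := by simpa using one_lt_log_of_three_le le_rfl
  have hy0 : 0 < Real.log (Real.log 3) := Real.log_pos h31
  have h3s : (1 : ℝ) ≤ 3 ^ s := Real.one_le_rpow (by norm_num) (by linarith)
  have hK1 : 1 ≤ 4 * z * 3 ^ s := by nlinarith
  have hK : 0 ≤ Real.log (4 * z * 3 ^ s) := Real.log_nonneg hK1
  -- The additive constant is absorbed into the iterated logarithm, which for `n ≥ 3` is at least
  -- `log (log 3) > 0`.
  refine ⟨Real.log (4 * z * 3 ^ s) / Real.log (Real.log 3) + s, ?_, fun δ hδ0 hδ1 n hn => ?_⟩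
  · have : 0 ≤ Real.log (4 * z * 3 ^ s) / Real.log (Real.log 3) := by positivity
    linarith
  have hn3 : (3 : ℝ) ≤ n := by exact_mod_cast hn
  have hln := one_lt_log_of_three_le hn
  have hl3 : Real.log 3 ≤ Real.log n := Real.log_le_log (by norm_num) hn3
  have hj : ((Nat.log 2 n : ℕ) : ℝ) + 1 ≤ 3 * Real.log n := by
    have h1 : (2 : ℝ) ^ (Nat.log 2 n) ≤ n := by
      exact_mod_cast Nat.pow_log_le_self 2 (by omega)
    have h2 := Real.log_le_log (by positivity) h1
    rw [Real.log_pow] at h2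
    have h3 := Real.log_two_gt_d9
    nlinarith [Nat.cast_nonneg (α := ℝ) (Nat.log 2 n)]
  have hdiv : Real.log n ≤ Real.log n / δ := by
    rw [le_div_iff₀ hδ0]; nlinarith
  have hy : Real.log (Real.log 3) ≤ Real.log (Real.log n / δ) :=
    Real.log_le_log (by linarith) (hl3.trans hdiv)
  have hst : 4 * stitch s (Nat.log 2 n : ℝ) / δ ≤ 4 * z * 3 ^ s * (Real.log n / δ) ^ s := by
    have h1 : ((Nat.log 2 n : ℝ) + 1) ^ s ≤ (3 * Real.log n) ^ s := by gcongr
    have h2 : (3 * Real.log n) ^ s = 3 ^ s * Real.log n ^ s :=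
      Real.mul_rpow (by norm_num) (by linarith)
    have h3 : (Real.log n / δ) ^ s = Real.log n ^ s / δ ^ s :=
      Real.div_rpow (by linarith) hδ0.le s
    have h4 : δ ^ s ≤ δ := by
      simpa using Real.rpow_le_rpow_of_exponent_ge hδ0 hδ1.le hs.le
    have h5 : 0 < δ ^ s := by positivity
    have h6 : 0 ≤ Real.log n ^ s := by positivity
    rw [h3]
    calc 4 * stitch s (Nat.log 2 n : ℝ) / δ
        = 4 * (((Nat.log 2 n : ℝ) + 1) ^ s * z) / δ := rfl
      _ ≤ 4 * ((3 ^ s * Real.log n ^ s) * z) / δ := by rw [← h2]; gcongr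
      _ ≤ 4 * ((3 ^ s * Real.log n ^ s) * z) / δ ^ s := by gcongr
      _ = _ := by ring
  have hpos : 0 < Real.log n / δ := by positivity
  have hst0 : 0 < 4 * stitch s (Nat.log 2 n : ℝ) / δ := by
    have := one_le_stitch hs (Nat.log 2 n)
    positivity
  calc Real.log (4 * stitch s (Nat.log 2 n : ℝ) / δ)
      ≤ Real.log (4 * z * 3 ^ s * (Real.log n / δ) ^ s) := Real.log_le_log hst0 hst
    _ = Real.log (4 * z * 3 ^ s) + s * Real.log (Real.log n / δ) := by
        rw [Real.log_mul (by positivity) (by positivity), Real.log_rpow hpos]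
    _ ≤ Real.log (4 * z * 3 ^ s) / Real.log (Real.log 3) * Real.log (Real.log n / δ)
        + s * Real.log (Real.log n / δ) := by
        gcongr
        rw [div_mul_eq_mul_div, le_div_iff₀ hy0]
        gcongr
    _ = _ := by ring

theorem lilRate_nonneg {p β v δ : ℝ} (hβ : 0 ≤ β) (hv : 0 ≤ v) (hδ0 : 0 < δ) (hδ1 : δ < 1)
    {n : ℕ} (hn : 3 ≤ n) : 0 ≤ lilRate p β v δ n := by
  have hln := one_lt_log_of_three_le hn
  have : 1 ≤ Real.log n / δ := by rw [le_div_iff₀ hδ0]; linarith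
  have := Real.log_nonneg this
  unfold lilRate
  positivity

/-- The balanced epoch bound is at most a multiple of the iterated-logarithm rate. -/
theorem balanced_le_lilRate {p β v δ Q L M c : ℝ} (hp1 : 1 < p) (hβ : 0 ≤ β) (hv : 0 < v)
    (hδ0 : 0 < δ) (hδ1 : δ < 1) {n : ℕ} (hn : 3 ≤ n) (hM : 1 ≤ M) (hc : 1 ≤ c) (hQ0 : 0 ≤ Q)
    (hQ : Q ≤ M * v) (hL0 : 0 ≤ L) (hL : L ≤ c * Real.log (Real.log n / δ)) :
    1444 * (β * (Q ^ (1 / p) * (L / 2 ^ Nat.log 2 n) ^ ((p - 1) / p)))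
      ≤ 2888 * M * c * lilRate p β v δ n := by
  have hp0 : 0 < p := by linarith
  have hln := one_lt_log_of_three_le hn
  have hn0 : (0 : ℝ) < n := by
    have : 0 < n := by omega
    exact_mod_cast this
  have hy : 0 ≤ Real.log (Real.log n / δ) :=
    Real.log_nonneg (by rw [le_div_iff₀ hδ0]; linarith)
  -- Constants at least 1 do not grow under exponents at most 1, so `M` and `2c` leave the powers
  -- unchanged. The 2 comes from `n ≤ 2 · 2^j`.
  have hroot : ∀ b e : ℝ, 1 ≤ b → e ≤ 1 → b ^ e ≤ b := fun b e hb he => by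
    simpa using Real.rpow_le_rpow_of_exponent_le hb he
  have he1 : 1 / p ≤ 1 := (div_le_one hp0).2 hp1.le
  have he2 : (p - 1) / p ≤ 1 := (div_le_one hp0).2 (by linarith)
  have he3 : 0 ≤ (p - 1) / p := div_nonneg (by linarith) hp0.le
  have h1 : Q ^ (1 / p) ≤ M * v ^ (1 / p) := by
    calc Q ^ (1 / p) ≤ (M * v) ^ (1 / p) := by gcongr
      _ = M ^ (1 / p) * v ^ (1 / p) := Real.mul_rpow (by linarith) hv.le
      _ ≤ _ := by
        gcongr
        exact hroot _ _ hM he1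
  have hw : (n : ℝ) ≤ 2 * 2 ^ Nat.log 2 n := by
    have : n ≤ 2 ^ (Nat.log 2 n + 1) := (Nat.lt_pow_succ_log_self (by norm_num) n).le
    have h2 : (n : ℝ) ≤ 2 ^ (Nat.log 2 n + 1) := by exact_mod_cast this
    rwa [pow_succ, mul_comm] at h2
  have h2 : L / 2 ^ Nat.log 2 n ≤ 2 * c * (Real.log (Real.log n / δ) / n) := by
    rw [div_le_iff₀ (by positivity), ← mul_div_assoc, div_mul_eq_mul_div, le_div_iff₀ hn0]
    calc L * n ≤ c * Real.log (Real.log n / δ) * (2 * 2 ^ Nat.log 2 n) := by gcongr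
      _ = _ := by ring
  have h3 : (L / 2 ^ Nat.log 2 n) ^ ((p - 1) / p)
      ≤ 2 * c * (Real.log (Real.log n / δ) / n) ^ ((p - 1) / p) := by
    calc _ ≤ (2 * c * (Real.log (Real.log n / δ) / n)) ^ ((p - 1) / p) := by gcongr
      _ = (2 * c) ^ ((p - 1) / p) * (Real.log (Real.log n / δ) / n) ^ ((p - 1) / p) :=
        Real.mul_rpow (by linarith) (by positivity)
      _ ≤ _ := by
        gcongr
        exact hroot _ _ (by linarith) he2
  calc _ ≤ 1444 * (β * (M * v ^ (1 / p) *
        (2 * c * (Real.log (Real.log n / δ) / n) ^ ((p - 1) / p)))) := by gcongr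
    _ = _ := by rw [lilRate]; ring

theorem norm_truncMean_sub {B : Type*} [NormedAddCommGroup B] [NormedSpace ℝ B] (x : ℕ → B)
    {k n : ℕ} (hkn : k < n) (lam : ℝ) (z m : B) :
    ‖truncMean x k n lam z - m‖ = ((n : ℝ) - k)⁻¹ *
      ‖∑ i ∈ Finset.Ioc k n, (trunc (lam • (x i - z)) • (x i - z) + z - m)‖ := by
  have h0 : 0 < (n : ℝ) - k := sub_pos.2 (by exact_mod_cast hkn)
  have h1 : truncMean x k n lam z - m = ((n : ℝ) - k)⁻¹ •
      ∑ i ∈ Finset.Ioc k n, (trunc (lam • (x i - z)) • (x i - z) + z - m) := by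
    rw [Finset.sum_sub_distrib, Finset.sum_const, Nat.card_Ioc, smul_sub, truncMean,
      ← Nat.cast_smul_eq_nsmul ℝ, Nat.cast_sub hkn.le, inv_smul_smul₀ h0.ne']
  rw [h1, norm_smul, Real.norm_of_nonneg (by positivity)]

/-! ### One epoch, and the union over epochs. -/

section Epoch

variable {Ω B : Type*} {mΩ : MeasurableSpace Ω} [NormedAddCommGroup B] [NormedSpace ℝ B]
  [CompleteSpace B] [TopologicalSpace.SeparableSpace B] [MeasurableSpace B] [BorelSpace B]
  {P : Measure Ω} [IsProbabilityMeasure P] {ℱ : Filtration ℕ mΩ} {X : ℕ → Ω → B} {m : B}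
  {k : ℕ → ℕ} {Zhat : (j : ℕ) → (Fin (k j) → B) → B} {s p β v δ : ℝ} {r : ℝ → ℕ → ℝ}

omit [CompleteSpace B] [NormedSpace ℝ B] in
theorem stronglyMeasurable_initEst {j : ℕ}
    (hX : ∀ n, 1 ≤ n → StronglyMeasurable[ℱ n] (X n)) (hZ : Measurable (Zhat j)) :
    StronglyMeasurable[ℱ (k j)] (initEst k Zhat X j) := by
  have : SecondCountableTopology B := UniformSpace.secondCountable_of_separable B
  have h1 : Measurable[ℱ (k j)] fun ω => (fun i : Fin (k j) => X (i + 1) ω) :=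
    @measurable_pi_lambda _ _ _ (ℱ (k j)) _ _ fun i =>
      ((hX (i + 1) (by omega)).mono (ℱ.mono (by omega))).measurable
  exact (hZ.comp h1).stronglyMeasurable

/-- Within one epoch the estimator satisfies the balanced bound, up to a small probability. -/
theorem measure_epoch_bad_le (hs : 1 < s) (hp1 : 1 < p) (hp2 : p ≤ 2) (hv : 0 < v) (hδ0 : 0 < δ)
    (hδ1 : δ < 1) {n₀ : ℕ} (hk : ∀ n : ℕ, n₀ ≤ n → (k (Nat.log 2 n) : ℝ) ≤ (n : ℝ) / 2)
    (hβ : 1 ≤ β) (h : IsSmoothSpace B β) (hA : MeanAssumption P ℱ X m p v) {j : ℕ}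
    (hZ : Measurable (Zhat j)) (hr : 0 < epochRate s δ k r j)
    (hPZ : P {ω | epochRate s δ k r j ≤ ‖initEst k Zhat X j ω - m‖} ≤
      ENNReal.ofReal ((stitch s (j : ℝ))⁻¹ * δ / 2)) :
    P {ω | ∃ n, n₀ ≤ n ∧ 3 ≤ n ∧ Nat.log 2 n = j ∧
        1444 * (β * ((v + epochRate s δ k r j ^ p) ^ (1 / p) *
          (Real.log (4 * stitch s (j : ℝ) / δ) / 2 ^ j) ^ ((p - 1) / p))) <
        ‖stitchedEst s p β v δ k r Zhat X n ω - m‖}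
      ≤ ENNReal.ofReal ((stitch s (j : ℝ))⁻¹ * δ) := by
  have hh := one_le_stitch hs j
  set H := stitch s (j : ℝ) with hH
  set ρ := epochRate s δ k r j with hρ
  set lam := truncLevel B s p β v δ k r j with hlam
  have hH0 : 0 < H := by linarith
  have hQ : 0 < v + ρ ^ p := by positivity
  obtain ⟨hE1, hE2⟩ := truncLevel_const_bounds B hp1 hp2 hβ
  have hE0 : 0 < β * Cconst B p β + 2 ^ (p - 1) * Kconst p := by linarith
  have h4 : 4 ≤ 4 * H / δ := by rw [le_div_iff₀ hδ0]; nlinarith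
  have hL1 : 1 ≤ Real.log (4 * H / δ) := by
    rw [Real.le_log_iff_exp_le (by linarith)]
    linarith [Real.exp_one_lt_d9]
  have hlam0 : 0 < lam := by
    have : 0 < Real.log (4 * H / δ) := by linarith
    rw [hlam, truncLevel]
    positivity
  have hα : 0 < H⁻¹ * δ / 2 := by positivity
  have hl : Real.log (1 / (H⁻¹ * δ / 2)) ≤ Real.log (4 * H / δ) := by
    refine Real.log_le_log (by positivity) ?_
    have : 1 / (H⁻¹ * δ / 2) = 2 * H / δ := by field_simp
    rw [this]
    gcongr
    norm_num
  -- If `k j` lies beyond the epoch, no `n ≥ n₀` belongs to it, because `k j ≤ n / 2` would fail.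
  rcases lt_or_ge (2 ^ (j + 1)) (k j) with hkj | hkj
  · convert zero_le (a := ENNReal.ofReal (H⁻¹ * δ))
    convert measure_empty (μ := P)
    refine Set.eq_empty_of_forall_notMem fun ω ⟨n, h1, h2, h3, _⟩ => ?_
    have h5 := hk n h1
    rw [h3] at h5
    have h6 : n < 2 ^ (j + 1) := h3 ▸ Nat.lt_pow_succ_log_self (by norm_num) n
    have h7 : (n : ℝ) < k j := by exact_mod_cast h6.trans hkj
    linarith [Nat.cast_nonneg (α := ℝ) n]
  have hmain := h.measure_norm_trunc_sum_gt_le hβ hA hp1.le hp2 hv.le hr.le hlam0 hkj hα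
    (stronglyMeasurable_initEst hA.adapted hZ) hPZ
  refine (measure_mono ?_).trans (hmain.trans (by rw [mul_div_cancel₀ _ two_ne_zero]))
  rintro ω ⟨n, h1, h2, h3, h5⟩
  have hkn := hk n h1
  rw [h3] at hkn
  have hn0 : (3 : ℝ) ≤ n := by exact_mod_cast h2
  have hknlt : k j < n := by
    have : (k j : ℝ) < n := by linarith
    exact_mod_cast this
  have hnT : n ≤ 2 ^ (j + 1) := h3 ▸ (Nat.lt_pow_succ_log_self (by norm_num) n).le
  have hnw : (2 : ℝ) ^ j ≤ n := by
    have : 2 ^ j ≤ n := h3 ▸ Nat.pow_log_le_self 2 (by omega)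
    exact_mod_cast this
  refine ⟨n, hknlt.le, hnT, ?_⟩
  by_contra! hcon
  have hst : stitchedEst s p β v δ k r Zhat X n ω =
      truncMean (fun i => X i ω) (k j) n lam (initEst k Zhat X j ω) := by
    rw [stitchedEst, if_pos (by omega), h3]
  rw [hst, norm_truncMean_sub _ hknlt] at h5
  have ha : 0 < (n : ℝ) - k j := by linarith
  have hbal := balanced_bound_le (p := p) (Q := v + ρ ^ p) (L := Real.log (4 * H / δ))
    (w := 2 ^ j) (lam := lam) (a := (n : ℝ) - k j) (l := Real.log (1 / (H⁻¹ * δ / 2)))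
    (τ := ((2 ^ (j + 1) : ℕ) : ℝ) - k j) hp1 hβ hE1 hE2 hQ hL1 (by positivity) rfl
    (by linarith) hl (sub_nonneg.2 (by exact_mod_cast hkj))
    (by push_cast; rw [pow_succ]; linarith [Nat.cast_nonneg (α := ℝ) (k j)])
  have hmul := mul_le_mul_of_nonneg_left hcon (inv_nonneg.2 ha.le)
  linarith

/-- All epochs satisfy their balanced bounds simultaneously with probability at least `1 - δ`. -/
theorem le_measure_balanced_bound (hs : 1 < s) (hp1 : 1 < p) (hp2 : p ≤ 2) (hv : 0 < v)
    (hδ0 : 0 < δ) (hδ1 : δ < 1) {n₀ : ℕ}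
    (hk : ∀ n : ℕ, n₀ ≤ n → (k (Nat.log 2 n) : ℝ) ≤ (n : ℝ) / 2)
    (hβ : 1 ≤ β) (h : IsSmoothSpace B β) (hA : MeanAssumption P ℱ X m p v)
    (hZ : ∀ j : ℕ, 1 ≤ j → Measurable (Zhat j)) (hr : ∀ j, 1 ≤ j → 0 < epochRate s δ k r j)
    (hPZ : ∀ j, 1 ≤ j → P {ω | epochRate s δ k r j ≤ ‖initEst k Zhat X j ω - m‖} ≤
      ENNReal.ofReal ((stitch s (j : ℝ))⁻¹ * δ / 2)) :
    ENNReal.ofReal (1 - δ) ≤ P {ω | ∀ n, n₀ ≤ n → 3 ≤ n →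
      ‖stitchedEst s p β v δ k r Zhat X n ω - m‖ ≤
        1444 * (β * ((v + epochRate s δ k r (Nat.log 2 n) ^ p) ^ (1 / p) *
          (Real.log (4 * stitch s (Nat.log 2 n : ℝ) / δ) / 2 ^ Nat.log 2 n) ^ ((p - 1) / p)))} := by
  let E : ℕ → Set Ω := fun j => {ω | ∃ n, n₀ ≤ n ∧ 3 ≤ n ∧ Nat.log 2 n = j ∧
        1444 * (β * ((v + epochRate s δ k r j ^ p) ^ (1 / p) *
          (Real.log (4 * stitch s (j : ℝ) / δ) / 2 ^ j) ^ ((p - 1) / p))) <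
        ‖stitchedEst s p β v δ k r Zhat X n ω - m‖}
  have hE : ∀ j, P (E j) ≤ ENNReal.ofReal ((stitch s (j : ℝ))⁻¹ * δ) := by
    intro j
    rcases Nat.eq_zero_or_pos j with rfl | hj
    · have : E 0 = ∅ := by
        refine Set.eq_empty_of_forall_notMem fun ω ⟨n, _, h2, h3, _⟩ => ?_
        have : 1 ≤ Nat.log 2 n := Nat.log_pos (by norm_num) (by omega)
        omega
      rw [this, measure_empty]
      exact zero_le
    · exact measure_epoch_bad_le hs hp1 hp2 hv hδ0 hδ1 hk hβ h hA (hZ j hj) (hr j hj) (hPZ j hj)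
  have hsum : HasSum (fun j : ℕ => (stitch s (j : ℝ))⁻¹ * δ) δ := by
    simpa using (hasSum_inv_stitch hs).mul_right δ
  have hpos : ∀ j : ℕ, 0 ≤ (stitch s (j : ℝ))⁻¹ * δ := fun j => by
    have := one_le_stitch hs j
    positivity
  have hbad : P (⋃ j, E j) ≤ ENNReal.ofReal δ := by
    refine (measure_iUnion_le E).trans ((ENNReal.tsum_le_tsum hE).trans (le_of_eq ?_))
    rw [← ENNReal.ofReal_tsum_of_nonneg hpos hsum.summable, hsum.tsum_eq]
  -- Subadditivity alone gives the lower bound on the complement, so measurability of the bad events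
  -- is not needed.
  have hone : 1 ≤ P (⋃ j, E j) + P (⋃ j, E j)ᶜ := by
    rw [← measure_univ (μ := P), ← Set.union_compl_self (⋃ j, E j)]
    exact measure_union_le _ _
  rw [ENNReal.ofReal_sub _ hδ0.le, ENNReal.ofReal_one, tsub_le_iff_left]
  refine hone.trans (add_le_add hbad (measure_mono fun ω hω n h1 h2 => ?_))
  by_contra! hcon
  exact hω (Set.mem_iUnion.2 ⟨Nat.log 2 n, n, h1, h2, rfl, hcon⟩)

end Epoch

end BanachMean

/-! ### Assembly of the theorem. -/

theorem mainTheorem4 (s : ℝ) (hs : 1 < s) :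
    ∃ C : ℝ, 0 < C ∧
      ∀ (p v δ : ℝ) (k : ℕ → ℕ) (n₀ : ℕ) (r : ℝ → ℕ → ℝ),
        1 < p → p ≤ 2 → 0 < v → 0 < δ → δ < 1 →
        Monotone k →
        (fun n : ℕ => (k (Nat.log 2 n) : ℝ)) =o[atTop] (fun n : ℕ => (n : ℝ)) →
        (∀ n : ℕ, n₀ ≤ n → (k (Nat.log 2 n) : ℝ) ≤ (n : ℝ) / 2) →
        Tendsto (fun n : ℕ => BanachMean.epochRate s δ k r (Nat.log 2 n)) atTop (𝓝 0) →
        ∃ (A : ℝ) (N : ℕ), 0 < A ∧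
          ∀ (B : Type*) [NormedAddCommGroup B] [NormedSpace ℝ B] [CompleteSpace B]
            [TopologicalSpace.SeparableSpace B] [MeasurableSpace B] [BorelSpace B]
            (β : ℝ) (Ω : Type*) (mΩ : MeasurableSpace Ω) (P : Measure Ω) [IsProbabilityMeasure P]
            (ℱ : Filtration ℕ mΩ) (X : ℕ → Ω → B) (m : B)
            (Zhat : (j : ℕ) → (Fin (k j) → B) → B),
            0 < β → BanachMean.IsSmoothSpace B β →
            BanachMean.MeanAssumption P ℱ X m p v →
            (∀ j : ℕ, 1 ≤ j → Measurable (Zhat j)) →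
            (∀ j : ℕ, 1 ≤ j → ∀ ε : ℝ, 0 < ε → ε < 1 →
              P {ω | r ε (k j) ≤ ‖BanachMean.initEst k Zhat X j ω - m‖} ≤ ENNReal.ofReal ε) →
            ENNReal.ofReal (1 - δ) ≤
              P {ω |
                (∀ n : ℕ, n₀ ≤ n → 3 ≤ n →
                  ‖BanachMean.stitchedEst s p β v δ k r Zhat X n ω - m‖
                    ≤ A * BanachMean.lilRate p β v δ n) ∧
                (∀ n : ℕ, N ≤ n →
                  ‖BanachMean.stitchedEst s p β v δ k r Zhat X n ω - m‖
                    ≤ C * BanachMean.lilRate p β v δ n)} := by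
  obtain ⟨c, hc1, hc⟩ := BanachMean.exists_log_stitch_le hs
  -- This is `M = 2` in `balanced_le_lilRate`, available once `r_n^p < v`. For `A` below, `M = 1 +
  -- R^p / v` with `R` a bound on all `|r_n|`.
  refine ⟨2888 * 2 * c, by positivity, ?_⟩
  intro p v δ k n₀ r hp1 hp2 hv hδ0 hδ1 _ _ hk hr0
  have hp0 : 0 < p := by linarith
  obtain ⟨R, hR⟩ : ∃ R : ℝ, ∀ n : ℕ, |BanachMean.epochRate s δ k r (Nat.log 2 n)| ≤ R := by
    obtain ⟨R, hR⟩ := (Metric.isBounded_range_of_tendsto _ hr0).exists_norm_le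
    exact ⟨R, fun n => hR _ ⟨n, rfl⟩⟩
  have hR0 : 0 ≤ R := (abs_nonneg _).trans (hR 0)
  have hsmall : ∀ᶠ n : ℕ in atTop, |BanachMean.epochRate s δ k r (Nat.log 2 n)| ^ p < v := by
    have h1 := (hr0.abs).rpow_const (p := p) (Or.inr hp0.le)
    rw [abs_zero, Real.zero_rpow hp0.ne'] at h1
    exact h1.eventually_lt_const hv
  obtain ⟨N, hN⟩ := eventually_atTop.1 hsmall
  have hM : 1 ≤ 1 + R ^ p / v := by
    have : 0 ≤ R ^ p / v := by positivity
    linarith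
  refine ⟨2888 * (1 + R ^ p / v) * c, max N (max n₀ 3), by positivity, ?_⟩
  intro B _ _ _ _ _ _ β Ω mΩ P _ ℱ X m Zhat hβ0 hsm hA hZ hPZ
  -- The trivial space is smooth for every `β > 0`, so `β ≥ 1` is unavailable there; but all norms
  -- vanish.
  rcases subsingleton_or_nontrivial B with hB | hB
  · have hnorm : ∀ b : B, ‖b‖ = 0 := fun b => by rw [Subsingleton.elim b 0, norm_zero]
    have hset : {ω | (∀ n : ℕ, n₀ ≤ n → 3 ≤ n →
          ‖BanachMean.stitchedEst s p β v δ k r Zhat X n ω - m‖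
            ≤ 2888 * (1 + R ^ p / v) * c * BanachMean.lilRate p β v δ n) ∧
        (∀ n : ℕ, max N (max n₀ 3) ≤ n →
          ‖BanachMean.stitchedEst s p β v δ k r Zhat X n ω - m‖
            ≤ 2888 * 2 * c * BanachMean.lilRate p β v δ n)} = Set.univ := by
      refine Set.eq_univ_of_forall fun ω => ⟨fun n _ h3 => ?_, fun n h => ?_⟩
      · have := BanachMean.lilRate_nonneg (p := p) hβ0.le hv.le hδ0 hδ1 h3
        rw [hnorm]
        positivity
      · have := BanachMean.lilRate_nonneg (p := p) (n := n) hβ0.le hv.le hδ0 hδ1 (by omega)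
        rw [hnorm]
        positivity
    rw [hset, measure_univ]
    exact ENNReal.ofReal_le_one.2 (by linarith)
  have hβ := hsm.one_le hβ0
  have hPZ' : ∀ j, 1 ≤ j →
      P {ω | BanachMean.epochRate s δ k r j ≤ ‖BanachMean.initEst k Zhat X j ω - m‖} ≤
        ENNReal.ofReal ((BanachMean.stitch s (j : ℝ))⁻¹ * δ / 2) ∧
      ENNReal.ofReal ((BanachMean.stitch s (j : ℝ))⁻¹ * δ / 2) < 1 := fun j hj => by
    have h1 := BanachMean.one_le_stitch hs j
    have h2 := inv_le_one_of_one_le₀ h1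
    have h3 : 0 < (BanachMean.stitch s (j : ℝ))⁻¹ := by positivity
    have h4 : (BanachMean.stitch s (j : ℝ))⁻¹ * δ / 2 < 1 := by nlinarith
    exact ⟨hPZ j hj _ (by positivity) h4, ENNReal.ofReal_lt_one.2 h4⟩
  -- A nonpositive rate would make the failure event sure, contradicting its probability bound below
  -- 1.
  have hrpos : ∀ j, 1 ≤ j → 0 < BanachMean.epochRate s δ k r j := fun j hj => by
    by_contra! hneg
    obtain ⟨h1, h2⟩ := hPZ' j hj
    have h3 : {ω | BanachMean.epochRate s δ k r j ≤ ‖BanachMean.initEst k Zhat X j ω - m‖} =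
        Set.univ := Set.eq_univ_of_forall fun ω => hneg.trans (norm_nonneg _)
    rw [h3, measure_univ] at h1
    exact absurd h2 (not_lt.2 h1)
  refine (BanachMean.le_measure_balanced_bound hs hp1 hp2 hv hδ0 hδ1 hk hβ hsm hA hZ hrpos
    fun j hj => (hPZ' j hj).1).trans (measure_mono fun ω hω => ?_)
  have hfin : ∀ (M : ℝ) (n : ℕ), n₀ ≤ n → 3 ≤ n → 1 ≤ M →
      v + BanachMean.epochRate s δ k r (Nat.log 2 n) ^ p ≤ M * v →
      ‖BanachMean.stitchedEst s p β v δ k r Zhat X n ω - m‖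
        ≤ 2888 * M * c * BanachMean.lilRate p β v δ n := fun M n h0 h3 hM1 hMv => by
    have hlog : 1 ≤ Nat.log 2 n := Nat.log_pos (by norm_num) (by omega)
    have hrn := hrpos _ hlog
    have hL0 : 0 ≤ Real.log (4 * BanachMean.stitch s (Nat.log 2 n : ℝ) / δ) := by
      refine Real.log_nonneg ?_
      rw [le_div_iff₀ hδ0]
      linarith [BanachMean.one_le_stitch hs (Nat.log 2 n)]
    exact (hω n h0 h3).trans (BanachMean.balanced_le_lilRate hp1 hβ0.le hv hδ0 hδ1 h3 hM1 hc1
      (by positivity) hMv hL0 (hc δ hδ0 hδ1 n h3))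
  have hrabs : ∀ n : ℕ, 3 ≤ n → BanachMean.epochRate s δ k r (Nat.log 2 n) =
      |BanachMean.epochRate s δ k r (Nat.log 2 n)| := fun n h3 =>
    (abs_of_pos (hrpos _ (Nat.log_pos (by norm_num) (by omega)))).symm
  refine ⟨fun n h0 h3 => hfin _ n h0 h3 hM ?_, fun n h => hfin 2 n (by omega) (by omega)
    (by norm_num) ?_⟩
  · rw [hrabs n h3, add_mul, one_mul, div_mul_cancel₀ _ hv.ne']
    have := hR n
    gcongr
  · rw [hrabs n (by omega)]
    linarith [hN n (by omega)]
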